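/- Notation. $\mathbb X,\mathbb Y$ are Euclidean spaces (finite-dimensional real inner product spaces), and $t_k\searrow 0$ means $t_k>0$, $t_k\to 0$. For a closed set $Q$ in a Euclidean space and $x\in Q$, let $$\mathcal T_Q(x)=\{d\mid \exists\, d_k\to d,\ t_k\searrow 0:\ x+t_kd_k\in Q\ \forall k\},\qquad \widehat{\mathcal N}_Q(x)=\{\eta\mid \langle\eta,x'-x\rangle\le o(\|x'-x\|)\ \forall x'\in Q\},$$ $$\mathcal N_Q(x)=\{\eta\mid \exists\, x_k\to x,\ \eta_k\to\eta:\ \eta_k\in\widehat{\mathcal N}_Q(x_k)\ \forall k\},\qquad \mathcal N_Q(x;d)=\{\eta\mid\exists\, d_k\to d,\ t_k\searrow0,\ \eta_k\to\eta:\ \eta_k\in\widehat{\mathcal N}_Q(x+t_kd_k)\ \forall k\};$$ for $x\notin Q$ the sets $\mathcal T_Q(x),\widehat{\mathcal N}_Q(x),\mathcal N_Q(x)$ are empty. For a set-valued mapping $\Psi$ with closed graph and $(x,y)\in\operatorname{gph}\Psi$, the graphical derivative $D\Psi(x,y)$ is the mapping with graph $\mathcal T_{\operatorname{gph}\Psi}(x,y)$.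 The graphical subderivative $D_{\rm sub}\Psi(x,y)$ assigns to a unit vector $u$ all unit vectors $v$ for which there are $u_k\to u$, $v_k\to v$, $t_k\searrow0$, $\tau_k\searrow0$ with $\tau_k/t_k\to\infty$ and $(x+t_ku_k,y+\tau_kv_k)\in\operatorname{gph}\Psi$ for all $k$. A subset of $\mathbb R^m$ is polyhedral if it is a finite union of convex polyhedral sets; $D\subset\mathbb R^m$ is locally polyhedral around $x\in D$ if $D\cap\{z\mid |z_i-x_i|\le\varepsilon,\ i=1,\dots,m\}$ is polyhedral for some $\varepsilon>0$. For $\Phi\colon\mathbb X\rightrightarrows\mathbb Y$ with closed graph, $(\bar x,0)\in\operatorname{gph}\Phi$, $u\in\mathbb X$ with $\|u\|=1$, and $v,y^*\in\mathbb Y$, Gfrerer's pseudo-coderivative of order 2, $\widetilde D^*_2\Phi((\bar x,0);(u,v))(y^*)$, is the set of all $x^*\in\mathbb X$ for which there are $u_k\to u$, $v_k\to v$, $t_k\searrow0$, $x_k^*\to x^*$, $y_k^*\to y^*$ with $$\Bigl(x_k^*,-\frac{y_k^*}{t_k\|u_k\|}\Bigr)\in\widehat{\mathcal N}_{\operatorname{gph}\Phi}(\bar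 x+t_ku_k,\;t_kv_k)\quad\forall k;$$ the pseudo-coderivative of order 2, $D^*_2\Phi((\bar x,0);(u,v))(y^*)$, is defined in the same way with $(t_k\|u_k\|)^2v_k$ in place of $t_kv_k$. Theorem. Let $g\colon\mathbb X\to\mathbb Y$ be twice continuously differentiable, let $D\subset\mathbb Y$ be closed, and let $\Phi(x)=g(x)-D$. Let $(\bar x,0)\in\operatorname{gph}\Phi$, $u\in\mathbb X$ with $\|u\|=1$, and $x^*\in\widetilde D^*_2\Phi((\bar x,0);(u,v))(y^*)$ for some $v,y^*\in\mathbb Y$. Consider the relations $$(1)\quad x^*=\nabla^2\langle y^*,g\rangle(\bar x)(u)+\nabla g(\bar x)^*z^*,\qquad(2)\quad y^*\in\mathcal N_D(g(\bar x);\nabla g(\bar x)u-v)\cap\ker\nabla g(\bar x)^*.$$ (i) There is $z^*\in\mathbb Y$ with $\langle y^*,z^*\rangle=0$ satisfying (1), and (2) holds. (ii) If $D\mathcal N_D(g(\bar x),y^*)(0)\cap\ker\nabla g(\bar x)^*=\{0\}$, or if $\nabla g(\bar x)u\ne v$ and $$D_{\rm sub}\mathcal N_D(g(\bar x),y^*)\Bigl(\tfrac{\nabla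 g(\bar x)u-v}{\|\nabla g(\bar x)u-v\|}\Bigr)\cap\ker\nabla g(\bar x)^*=\varnothing,$$ then there is $z^*\in D\mathcal N_D(g(\bar x),y^*)(\nabla g(\bar x)u-v)$ such that (1) and (2) hold. (iii) If $\mathbb Y=\mathbb R^m$ and $D$ is locally polyhedral around $g(\bar x)$, then $\mathcal N_D(g(\bar x);\nabla g(\bar x)u-v)=\mathcal N_{\mathcal T_D(g(\bar x))}(\nabla g(\bar x)u-v)$, and there is $z^*\in\mathcal T_{\mathcal N_{\mathcal T_D(g(\bar x))}(\nabla g(\bar x)u-v)}(y^*)$ such that (1) and (2) hold. (iv) Let $\mathbb Y=\mathbb R^m$, let $D$ be locally polyhedral around $g(\bar x)$, and let (now without assuming $x^*\in\widetilde D^*_2\Phi((\bar x,0);(u,v))(y^*)$) $x^*\in D^*_2\Phi((\bar x,0);(u,v))(y^*)$ for some $v,y^*\in\mathbb R^m$. Put $\mathbf T(u)=\mathcal T_{\mathcal T_D(g(\bar x))}(\nabla g(\bar x)u)$ and $w_s(u,v)=\nabla g(\bar x)s+\tfrac12\nabla^2g(\bar x)[u,u]-v$ for $s\in\mathbb X$.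 Then there are $s\in\mathbb X$ and $z^*\in\mathcal T_{\mathcal N_{\mathbf T(u)}(w_s(u,v))}(y^*)$ such that (1) holds and $y^*\in\mathcal N_{\mathbf T(u)}(w_s(u,v))\cap\ker\nabla g(\bar x)^*$. -/

import Mathlib

open Filter Topology

noncomputable section

namespace VarAnalysis

section Cones

variable {E : Type*} [NormedAddCommGroup E] [InnerProductSpace ℝ E]

/-- The (Bouligand) tangent cone `T_Q(x)` (empty if `x ∉ Q`). -/
def tangentCone (Q : Set E) (x : E) : Set E :=
  {d | x ∈ Q ∧ ∃ (dk : ℕ → E) (t : ℕ → ℝ), Tendsto dk atTop (𝓝 d) ∧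
    (∀ k, 0 < t k) ∧ Tendsto t atTop (𝓝 0) ∧ ∀ k, x + t k • dk k ∈ Q}

/-- On points of `Q`, `tangentCone` is Mathlib's `posTangentConeAt`. -/
theorem tangentCone_eq_posTangentConeAt {Q : Set E} {x : E} (hx : x ∈ Q) :
    tangentCone Q x = posTangentConeAt Q x := by
  ext y
  constructor
  · rintro ⟨-, dk, t, hd, ht, ht0, hQ⟩
    refine mem_tangentConeAt_of_seq atTop (fun k => (t k)⁻¹.toNNReal)
      (fun k => t k • dk k) (by simpa using ht0.smul hd) (Eventually.of_forall hQ) ?_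
    refine hd.congr fun k => ?_
    rw [NNReal.smul_def, Real.coe_toNNReal _ (inv_pos.2 (ht k)).le, smul_smul,
      inv_mul_cancel₀ (ht k).ne', one_smul]
  · intro h
    refine ⟨hx, ?_⟩
    by_cases hy : y = 0
    · subst hy
      refine ⟨fun _ => 0, fun k => 1 / ((k : ℝ) + 1), tendsto_const_nhds, fun k => by positivity,
        tendsto_one_div_add_atTop_nhds_zero_nat, fun k => by simpa using hx⟩
    · obtain ⟨α, l, hl, c, d, hd, hQ, hcd⟩ := exists_fun_of_mem_tangentConeAt h
      have key : ∀ k : ℕ, ∃ a, ‖y‖ / 2 < ‖c a • d a‖ ∧ ‖d a‖ < ‖y‖ / 2 * (1 / ((k : ℝ) + 1)) ∧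
          x + d a ∈ Q ∧ dist (c a • d a) y < 1 / ((k : ℝ) + 1) := by
        intro k
        have hp : 0 < ‖y‖ := norm_pos_iff.2 hy
        have e1 := hcd.norm.eventually (lt_mem_nhds (show ‖y‖ / 2 < ‖y‖ by linarith))
        have e2 := (tendsto_zero_iff_norm_tendsto_zero.1 hd).eventually
          (gt_mem_nhds (show (0 : ℝ) < ‖y‖ / 2 * (1 / ((k : ℝ) + 1)) by positivity))
        have e3 := Metric.tendsto_nhds.1 hcd (1 / ((k : ℝ) + 1)) (by positivity)
        exact (e1.and (e2.and (hQ.and e3))).exists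
      choose a h1 h2 h3 h4 using key
      have hp : 0 < ‖y‖ := norm_pos_iff.2 hy
      have hc : ∀ k, 0 < (c (a k) : ℝ) := by
        intro k
        refine lt_of_le_of_ne (c (a k)).2 fun h0 => ?_
        have := h1 k
        rw [NNReal.smul_def, ← h0] at this
        simp at this
        linarith
      refine ⟨fun k => c (a k) • d (a k), fun k => (c (a k) : ℝ)⁻¹, ?_,
        fun k => inv_pos.2 (hc k), ?_, fun k => ?_⟩
      · rw [tendsto_iff_dist_tendsto_zero]
        exact squeeze_zero (fun _ => dist_nonneg) (fun k => (h4 k).le)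
          tendsto_one_div_add_atTop_nhds_zero_nat
      · refine squeeze_zero (fun k => (inv_pos.2 (hc k)).le) (fun k => ?_)
          tendsto_one_div_add_atTop_nhds_zero_nat
        have h5 := h1 k
        rw [NNReal.smul_def, norm_smul, Real.norm_of_nonneg (hc k).le] at h5
        have h6 := mul_lt_mul_of_pos_left (h2 k) (hc k)
        rw [inv_le_comm₀ (hc k) (by positivity)]
        have h8 : (1 : ℝ) < c (a k) * (1 / ((k : ℝ) + 1)) := by
          by_contra hcon
          push Not at hcon
          nlinarith
        rw [mul_one_div, lt_div_iff₀ (by positivity)] at h8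
        rw [one_div, inv_inv]
        linarith
      · beta_reduce
        rw [NNReal.smul_def, smul_smul, inv_mul_cancel₀ (hc k).ne', one_smul]
        exact h3 k

/-- The regular (Fréchet) normal cone `N̂_Q(x)` (empty if `x ∉ Q`):
`⟪η, x' - x⟫ ≤ o(‖x' - x‖)` for `x' ∈ Q`. -/
def regNormalCone (Q : Set E) (x : E) : Set E :=
  {η | x ∈ Q ∧ ∀ ε : ℝ, 0 < ε → ∀ᶠ x' in 𝓝[Q] x, inner ℝ η (x' - x) ≤ ε * ‖x' - x‖}

/-- The limiting (Mordukhovich) normal cone `N_Q(x)` (empty if `x ∉ Q`). -/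
def limNormalCone (Q : Set E) (x : E) : Set E :=
  {η | x ∈ Q ∧ ∃ (xk ηk : ℕ → E), Tendsto xk atTop (𝓝 x) ∧ Tendsto ηk atTop (𝓝 η) ∧
    ∀ k, ηk k ∈ regNormalCone Q (xk k)}

/-- The directional limiting normal cone `N_Q(x; d)`. -/
def dirNormalCone (Q : Set E) (x d : E) : Set E :=
  {η | ∃ (dk : ℕ → E) (t : ℕ → ℝ) (ηk : ℕ → E), Tendsto dk atTop (𝓝 d) ∧
    (∀ k, 0 < t k) ∧ Tendsto t atTop (𝓝 0) ∧ Tendsto ηk atTop (𝓝 η) ∧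
    ∀ k, ηk k ∈ regNormalCone Q (x + t k • dk k)}

/-- Convex polyhedral sets: finite intersections of closed half-spaces. -/
def IsConvexPolyhedral (P : Set E) : Prop :=
  ∃ H : Finset (E × ℝ), P = {z | ∀ h ∈ H, inner ℝ h.1 z ≤ h.2}

/-- Polyhedral sets: finite unions of convex polyhedral sets. -/
def IsPolyhedral (Q : Set E) : Prop :=
  ∃ S : Set (Set E), S.Finite ∧ (∀ P ∈ S, IsConvexPolyhedral P) ∧ Q = ⋃₀ S

end Cones

/-- `Q ⊆ ℝᵐ` is locally polyhedral around `x`: its intersection with some box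
`{z | |zᵢ - xᵢ| ≤ ε for all i}`, `ε > 0`, is polyhedral. -/
def IsLocallyPolyhedral {m : ℕ} (Q : Set (EuclideanSpace ℝ (Fin m)))
    (x : EuclideanSpace ℝ (Fin m)) : Prop :=
  ∃ ε : ℝ, 0 < ε ∧ IsPolyhedral (Q ∩ {z | ∀ i, |z i - x i| ≤ ε})

section Maps

variable {X Y : Type*} [NormedAddCommGroup X] [InnerProductSpace ℝ X]
  [NormedAddCommGroup Y] [InnerProductSpace ℝ Y]

/-- The graph of a set-valued mapping `Φ : X ⇉ Y`, as a subset of the Euclidean product space. -/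
def gph (Φ : X → Set Y) : Set (WithLp 2 (X × Y)) :=
  {p | p.snd ∈ Φ p.fst}

/-- The graphical derivative `DΦ(x, y) : X ⇉ Y`. -/
def graphicalDeriv (Φ : X → Set Y) (x : X) (y : Y) (u : X) : Set Y :=
  {v | WithLp.toLp 2 (u, v) ∈ tangentCone (gph Φ) (WithLp.toLp 2 (x, y))}

/-- The graphical subderivative `D_sub Φ(x, y) : 𝕊_X ⇉ 𝕊_Y`;
it is used only for `u` in the unit sphere. -/
def graphicalSubderiv (Φ : X → Set Y) (x : X) (y : Y) (u : X) : Set Y :=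
  {v | ‖v‖ = 1 ∧ ∃ (uk : ℕ → X) (vk : ℕ → Y) (t τ : ℕ → ℝ),
    Tendsto uk atTop (𝓝 u) ∧ Tendsto vk atTop (𝓝 v) ∧
    (∀ k, 0 < t k) ∧ Tendsto t atTop (𝓝 0) ∧ (∀ k, 0 < τ k) ∧ Tendsto τ atTop (𝓝 0) ∧
    Tendsto (fun k => τ k / t k) atTop atTop ∧
    ∀ k, WithLp.toLp 2 (x + t k • uk k, y + τ k • vk k) ∈ gph Φ}

/-- The pseudo-coderivative of order `γ` of `Φ` at `(x, y)` in direction `(u, v)`, `‖u‖ = 1`. -/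
def pseudoCoderiv (γ : ℝ) (Φ : X → Set Y) (x : X) (y : Y) (u : X) (v : Y) (ys : Y) : Set X :=
  {xs | ∃ (uk xsk : ℕ → X) (vk ysk : ℕ → Y) (t : ℕ → ℝ),
    Tendsto uk atTop (𝓝 u) ∧ Tendsto vk atTop (𝓝 v) ∧
    (∀ k, 0 < t k) ∧ Tendsto t atTop (𝓝 0) ∧
    Tendsto xsk atTop (𝓝 xs) ∧ Tendsto ysk atTop (𝓝 ys) ∧
    ∀ k, WithLp.toLp 2 (xsk k, -(((t k * ‖uk k‖) ^ (γ - 1))⁻¹ • ysk k)) ∈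
      regNormalCone (gph Φ)
        (WithLp.toLp 2 (x + t k • uk k, y + (t k * ‖uk k‖) ^ γ • vk k))}

/-- Gfrerer's pseudo-coderivative of order `γ` of `Φ` at `(x, y)` in direction `(u, v)`,
`‖u‖ = 1`. -/
def gfrererPseudoCoderiv (γ : ℝ) (Φ : X → Set Y) (x : X) (y : Y) (u : X) (v : Y) (ys : Y) :
    Set X :=
  {xs | ∃ (uk xsk : ℕ → X) (vk ysk : ℕ → Y) (t : ℕ → ℝ),
    Tendsto uk atTop (𝓝 u) ∧ Tendsto vk atTop (𝓝 v) ∧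
    (∀ k, 0 < t k) ∧ Tendsto t atTop (𝓝 0) ∧
    Tendsto xsk atTop (𝓝 xs) ∧ Tendsto ysk atTop (𝓝 ys) ∧
    ∀ k, WithLp.toLp 2 (xsk k, -(((t k * ‖uk k‖) ^ (γ - 1))⁻¹ • ysk k)) ∈
      regNormalCone (gph Φ) (WithLp.toLp 2 (x + t k • uk k, y + t k • vk k))}

/-- The constraint mapping `Φ(x) = g(x) - D`. -/
def constraintMap (g : X → Y) (D : Set Y) (x : X) : Set Y :=
  {y | ∃ d ∈ D, y = g x - d}

variable [FiniteDimensional ℝ X] [FiniteDimensional ℝ Y]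

/-- The adjoint `∇g(x)* : Y → X` of the derivative of `g` at `x`. -/
def adjDeriv (g : X → Y) (x : X) : Y →L[ℝ] X :=
  ContinuousLinearMap.adjoint (fderiv ℝ g x)

/-- `ker ∇g(x)*`. -/
def kerAdjDeriv (g : X → Y) (x : X) : Set Y :=
  {y | adjDeriv g x y = 0}

/-- `∇²⟨ys, g⟩(x)(u)`, identified with an element of `X`: the derivative at `x` in direction `u`
of the gradient of the scalarization `⟨ys, g⟩`. -/
def scalarHess (ys : Y) (g : X → Y) (x u : X) : X :=
  fderiv ℝ (gradient (fun x' => (inner ℝ ys (g x') : ℝ))) x u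

/-- `∇²g(x)[u, u] = ∑ᵢ ⟪u, ∇²⟨eᵢ, g⟩(x)(u)⟫ eᵢ` for `g` with values in `ℝᵐ`. -/
def secondDeriv {m : ℕ} (g : X → EuclideanSpace ℝ (Fin m)) (x u : X) :
    EuclideanSpace ℝ (Fin m) :=
  ∑ i, (inner ℝ u (scalarHess (EuclideanSpace.single i (1 : ℝ)) g x u) : ℝ) •
    EuclideanSpace.single i (1 : ℝ)

/-- `𝐓(u) = T_{T_D(g(x))}(∇g(x)u)`. -/
def bigT {m : ℕ} (g : X → EuclideanSpace ℝ (Fin m)) (D : Set (EuclideanSpace ℝ (Fin m)))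
    (x u : X) : Set (EuclideanSpace ℝ (Fin m)) :=
  tangentCone (tangentCone D (g x)) (fderiv ℝ g x u)

/-- `w_s(u, v) = ∇g(x)s + 1/2 ∇²g(x)[u, u] - v`. -/
def wVec {m : ℕ} (g : X → EuclideanSpace ℝ (Fin m)) (x s u : X)
    (v : EuclideanSpace ℝ (Fin m)) : EuclideanSpace ℝ (Fin m) :=
  fderiv ℝ g x s + (1 / 2 : ℝ) • secondDeriv g x u - v

end Maps

end VarAnalysis

end

open VarAnalysis

/-!
A regular normal to the graph of `Φ = g - D` at `(x, w)` has the form `(∇g(x)* y, -y)` with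
`y ∈ N̂_D(g(x) - w)`. Hence the elements of a pseudo-coderivative come from `t k ↘ 0`, `u k → u` and
regular normals `y k → y*` to `D` with `(t k)⁻¹ ∇g(x̄ + t k u k)* (y k) → x*`. Expanding the adjoint
to first order gives `∇g(x̄)* y* = 0` and

  `∇g(x̄)* ((y k - y*) / t k) → x* - ∇²⟨y*, g⟩(x̄)(u)`,

so that `z*` has to be found as a limit of the quotients `(y k - y*) / t k` modulo `ker ∇g(x̄)*`.
For (i) the range of `∇g(x̄)*` is closed. Under either condition in (ii) the quotients are bounded:
otherwise their normalized limit would violate that condition. If `D` is locally polyhedral, the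
`y k` lie along a subsequence in one finitely generated cone `K`, and the image of
`K + ℝ₊ (-y*)` under `∇g(x̄)*` is closed because it is finitely generated as well.
-/

namespace VarAnalysis

section MinkowskiWeyl

variable {𝕜 M N : Type*} [Field 𝕜] [LinearOrder 𝕜] [IsStrictOrderedRing 𝕜]
  [AddCommGroup M] [Module 𝕜 M] [AddCommGroup N] [Module 𝕜 N] {p : M →ₗ[𝕜] N →ₗ[𝕜] 𝕜}

theorem mem_sup_hull_singleton_iff {C : PointedCone 𝕜 N} {v x : N} :
    x ∈ C ⊔ PointedCone.hull 𝕜 {v} ↔ ∃ t : 𝕜, 0 ≤ t ∧ x - t • v ∈ C := by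
  simp only [Submodule.mem_sup, Submodule.mem_span_singleton]
  constructor
  · rintro ⟨c, hc, -, ⟨t, rfl⟩, rfl⟩
    exact ⟨t, t.2, (add_sub_cancel_right c (t • v)).symm ▸ hc⟩
  · rintro ⟨t, ht, hc⟩
    exact ⟨_, hc, _, ⟨⟨t, ht⟩, rfl⟩, sub_add_cancel _ _⟩

/-- Fourier–Motzkin elimination: the constraints on `x` remaining after `t` is eliminated from
`0 ≤ t` and `0 ≤ p a (x - t • v)` for `a ∈ s`. -/
def fourierMotzkin (p : M →ₗ[𝕜] N →ₗ[𝕜] 𝕜) (s : Set M) (v : N) : Set M :=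
  {a ∈ s | 0 ≤ p a v} ∪
    Set.image2 (fun a b => p a v • b - p b v • a) {a ∈ s | 0 ≤ p a v} {b ∈ s | p b v < 0}

theorem dual_sup_hull_singleton_eq {s : Set M} (hs : s.Finite) (v : N) :
    PointedCone.dual p s ⊔ PointedCone.hull 𝕜 {v} = PointedCone.dual p (fourierMotzkin p s v) := by
  ext x
  simp only [mem_sup_hull_singleton_iff, PointedCone.mem_dual, map_sub, map_smul, smul_eq_mul,
    sub_nonneg]
  constructor
  · rintro ⟨t, ht, hx⟩ _ (⟨ha, hav⟩ | ⟨a, ⟨ha, hav⟩, b, ⟨hb, hbv⟩, rfl⟩)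
    · exact (mul_nonneg ht hav).trans (hx ha)
    · simp only [map_sub, map_smul, LinearMap.sub_apply, LinearMap.smul_apply, smul_eq_mul]
      linarith [mul_le_mul_of_nonneg_left (hx hb) hav,
        mul_le_mul_of_nonpos_left (hx ha) hbv.le]
  · intro hx
    have hfin : (insert 0 ((fun b => p b x / p b v) '' {b ∈ s | p b v < 0})).Finite :=
      ((hs.sep _).image _).insert 0
    obtain ⟨t, hmem, ht⟩ := hfin.exists_maximal (Set.insert_nonempty _ _)
    have ht' : ∀ r ∈ insert 0 ((fun b => p b x / p b v) '' {b ∈ s | p b v < 0}), r ≤ t :=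
      fun r hr => (le_total r t).elim id (ht hr)
    refine ⟨t, ht' 0 (Set.mem_insert _ _), fun a ha => ?_⟩
    rcases lt_or_ge (p a v) 0 with hav | hav
    · exact (div_le_iff_of_neg hav).1 (ht' _ (Or.inr ⟨a, ⟨ha, hav⟩, rfl⟩))
    · rcases hmem with rfl | ⟨b, ⟨hb, hbv⟩, rfl⟩
      · simpa using hx (Or.inl ⟨ha, hav⟩)
      · have h := hx (Or.inr ⟨a, ⟨ha, hav⟩, b, ⟨hb, hbv⟩, rfl⟩)
        simp only [map_sub, map_smul, LinearMap.sub_apply, LinearMap.smul_apply, smul_eq_mul] at h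
        rw [div_mul_eq_mul_div, div_le_iff_of_neg hbv]
        linarith

theorem dualFG_sup_hull_singleton {C : PointedCone 𝕜 N} (hC : C.DualFG p) (v : N) :
    (C ⊔ PointedCone.hull 𝕜 {v}).DualFG p := by
  obtain ⟨s, rfl⟩ := hC
  rw [dual_sup_hull_singleton_eq s.finite_toSet]
  have hfin (q : M → Prop) : {a ∈ (s : Set M) | q a}.Finite := s.finite_toSet.sep q
  exact .dual_of_finite p ((hfin _).union ((hfin _).image2 _ (hfin _)))

theorem dualFG_bot [Module.Finite 𝕜 M] (hp : Function.Injective p.flip) :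
    (⊥ : PointedCone 𝕜 N).DualFG p := by
  obtain ⟨s, hs⟩ := Module.finite_def.1 ‹Module.Finite 𝕜 M›
  have hs' : ((s : Set M) ∪ -s).Finite := s.finite_toSet.union s.finite_toSet.neg
  convert PointedCone.DualFG.dual_of_finite p hs'
  refine (eq_bot_iff.2 fun x hx => ?_).symm
  refine hp (LinearMap.ext_on hs fun a ha => ?_)
  have hneg := hx (Or.inr (by simpa using ha : -a ∈ -(s : Set M)))
  rw [map_neg, LinearMap.neg_apply, neg_nonneg] at hneg
  simpa using hneg.antisymm (hx (Or.inl ha))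

/-- Weyl's theorem. -/
theorem dualFG_of_fg [Module.Finite 𝕜 M] (hp : Function.Injective p.flip) {C : PointedCone 𝕜 N}
    (hC : C.FG) : C.DualFG p := by
  obtain ⟨s, rfl⟩ := hC
  classical
  induction s using Finset.induction with
  | empty => simpa using dualFG_bot hp
  | insert x s _ ih =>
    rw [Finset.coe_insert, Submodule.span_insert, sup_comm]
    exact dualFG_sup_hull_singleton ih x

/-- Minkowski's theorem. -/
theorem fg_of_dualFG [Module.Finite 𝕜 M] [Module.Finite 𝕜 N] (hp : Function.Injective p)
    (hp' : Function.Injective p.flip) {C : PointedCone 𝕜 N} (hC : C.DualFG p) : C.FG := by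
  obtain ⟨D, hD, rfl⟩ := hC.exists_fg_dual
  obtain ⟨E, hE, rfl⟩ := (dualFG_of_fg (p := p.flip) hp hD).exists_fg_dual
  rwa [(dualFG_of_fg hp' hE).dual_dual_flip]

end MinkowskiWeyl

section PolarCone

variable {E F : Type*} [NormedAddCommGroup E] [InnerProductSpace ℝ E]
  [NormedAddCommGroup F] [InnerProductSpace ℝ F]

/-- The polar cone `{y | ∀ x ∈ s, ⟪x, y⟫ ≤ 0}` of `s`, encoded as a dual cone with respect to
`-⟪·, ·⟫`. -/
noncomputable def polarCone (s : Set E) : PointedCone ℝ E :=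
  .dual (-innerₗ E) s

theorem mem_polarCone {s : Set E} {y : E} : y ∈ polarCone s ↔ ∀ x ∈ s, inner ℝ x y ≤ 0 := by
  simp [polarCone]

theorem isClosed_polarCone (s : Set E) : IsClosed (polarCone s : Set E) :=
  PointedCone.isClosed_dual fun x => (innerSL ℝ x).continuous.neg

theorem injective_neg_innerₗ : Function.Injective (-innerₗ E) := fun x y h =>
  ext_inner_right ℝ fun z => by simpa using LinearMap.congr_fun h z

theorem flip_neg_innerₗ : (-innerₗ E).flip = -innerₗ E := by
  ext x y
  simp [real_inner_comm]

variable [FiniteDimensional ℝ E]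

theorem fg_of_dualFG_neg_innerₗ {C : PointedCone ℝ E} (hC : C.DualFG (-innerₗ E)) : C.FG :=
  fg_of_dualFG injective_neg_innerₗ (by simpa [flip_neg_innerₗ] using injective_neg_innerₗ) hC

theorem fg_polarCone {s : Set E} (hs : s.Finite) : (polarCone s).FG :=
  fg_of_dualFG_neg_innerₗ (.dual_of_finite _ hs)

theorem isClosed_of_fg {C : PointedCone ℝ E} (hC : C.FG) : IsClosed (C : Set E) := by
  obtain ⟨s, rfl⟩ : C.DualFG (-innerₗ E) :=
    dualFG_of_fg (by simpa [flip_neg_innerₗ] using injective_neg_innerₗ) hC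
  exact isClosed_polarCone _

theorem isClosed_image_of_fg {C : PointedCone ℝ F} (hC : C.FG) (A : F →L[ℝ] E) :
    IsClosed (A '' C) :=
  isClosed_of_fg (C := C.map (A : F →ₗ[ℝ] E)) (hC.map _)

theorem exists_add_mem_of_tendsto_sub {C : PointedCone ℝ E} (hC : C.FG) {V : Submodule ℝ E}
    {e m : ℕ → E} {w : E} (he : ∀ k, e k ∈ C) (hm : ∀ k, m k ∈ V)
    (hw : Tendsto (fun k => e k - m k) atTop (𝓝 w)) : ∃ m' ∈ V, w + m' ∈ C := by
  have hker {x : E} : Vᗮ.starProjection x = 0 ↔ x ∈ V := by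
    rw [Submodule.starProjection_apply_eq_zero_iff, Submodule.orthogonal_orthogonal]
  obtain ⟨c, hc, hcw⟩ := (isClosed_image_of_fg hC Vᗮ.starProjection).mem_of_tendsto
    ((Vᗮ.starProjection.continuous.tendsto w).comp hw)
    (.of_forall fun k => ⟨e k, he k, by
      rw [Function.comp_apply, map_sub, hker.2 (hm k), sub_zero]⟩)
  exact ⟨c - w, hker.1 (by rw [map_sub, hcw, sub_self]), by simpa using hc⟩

end PolarCone

section TangentNormalCones

variable {E : Type*} [NormedAddCommGroup E] [InnerProductSpace ℝ E] {Q : Set E} {x η : E}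

theorem nonpos_of_forall_le_mul {a b : ℝ} (h : ∀ ε : ℝ, 0 < ε → a ≤ ε * b) : a ≤ 0 := by
  have hlim : Tendsto (fun ε : ℝ => ε * b) (𝓝[>] 0) (𝓝 0) := by
    simpa using (tendsto_id.mul_const b).mono_left (nhdsWithin_le_nhds (a := (0 : ℝ)))
  exact ge_of_tendsto hlim (eventually_mem_nhdsWithin.mono h)

theorem mem_tangentCone_of_eventually {d : E} (hx : x ∈ Q)
    (h : ∀ᶠ t : ℝ in 𝓝[>] 0, x + t • d ∈ Q) : d ∈ tangentCone Q x := by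
  obtain ⟨t, ht, hQ⟩ := exists_seq_forall_of_frequently (h.and self_mem_nhdsWithin).frequently
  exact ⟨hx, fun _ => d, t, tendsto_const_nhds, fun k => (hQ k).2,
    ht.mono_right nhdsWithin_le_nhds, fun k => (hQ k).1⟩

theorem tangentCone_mono {Q' : Set E} (h : Q ⊆ Q') : tangentCone Q x ⊆ tangentCone Q' x := by
  rintro d ⟨hx, dk, t, hd, ht, ht0, hQ⟩
  exact ⟨h hx, dk, t, hd, ht, ht0, fun k => h (hQ k)⟩

theorem mem_regNormalCone_iff : η ∈ regNormalCone Q x ↔ x ∈ Q ∧ ∀ ε : ℝ, 0 < ε →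
    ∀ᶠ w in 𝓝 (0 : E), x + w ∈ Q → inner ℝ η w ≤ ε * ‖w‖ := by
  simp only [regNormalCone, Set.mem_ofPred_eq, eventually_nhdsWithin_iff,
    ← map_add_left_nhds_zero x, eventually_map, add_sub_cancel_left]

theorem smul_mem_regNormalCone {r : ℝ} (hr : 0 < r) (h : η ∈ regNormalCone Q x) :
    r • η ∈ regNormalCone Q x := by
  refine ⟨h.1, fun ε hε => ?_⟩
  filter_upwards [h.2 (ε / r) (by positivity)] with x' hx'
  rw [real_inner_smul_left]
  calc r * inner ℝ η (x' - x) ≤ r * (ε / r * ‖x' - x‖) := mul_le_mul_of_nonneg_left hx' hr.le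
    _ = ε * ‖x' - x‖ := by field_simp

theorem tendsto_smul_nhds_zero (t : ℝ) : Tendsto (fun w : E => t • w) (𝓝 0) (𝓝 0) := by
  simpa using (continuous_const_smul t).tendsto (0 : E)

theorem regNormalCone_subset_of_eventually {T : Set E} {d : E} {t : ℝ} (ht : 0 < t)
    (h : ∀ᶠ w in 𝓝 0, x + t • w ∈ Q ↔ d + w ∈ T) : regNormalCone Q x ⊆ regNormalCone T d := by
  intro η hη
  rw [mem_regNormalCone_iff] at hη ⊢
  refine ⟨by simpa using h.self_of_nhds.1 (by simpa using hη.1), fun ε hε => ?_⟩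
  filter_upwards [h, (tendsto_smul_nhds_zero t).eventually (hη.2 ε hε)] with w hw hwη hwT
  have := hwη (hw.2 hwT)
  rw [real_inner_smul_right, norm_smul, Real.norm_of_nonneg ht.le, mul_left_comm] at this
  exact le_of_mul_le_mul_left this ht

theorem regNormalCone_eq_of_eventually {T : Set E} {d : E} {t : ℝ} (ht : 0 < t)
    (h : ∀ᶠ w in 𝓝 0, x + t • w ∈ Q ↔ d + w ∈ T) : regNormalCone Q x = regNormalCone T d := by
  refine (regNormalCone_subset_of_eventually ht h).antisymm
    (regNormalCone_subset_of_eventually (inv_pos.2 ht) ?_)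
  filter_upwards [(tendsto_smul_nhds_zero t⁻¹).eventually h] with w hw
  rw [← hw, smul_inv_smul₀ ht.ne']

theorem regNormalCone_zero_eq_polarCone (h0 : (0 : E) ∈ Q)
    (hcone : ∀ t : ℝ, 0 < t → ∀ w ∈ Q, t • w ∈ Q) : regNormalCone Q 0 = polarCone Q := by
  ext η
  simp only [mem_regNormalCone_iff, SetLike.mem_coe, mem_polarCone, zero_add]
  refine ⟨fun ⟨_, hη⟩ w hw => ?_, fun h => ⟨h0, fun ε hε => .of_forall fun w hw => ?_⟩⟩
  · have hle (ε : ℝ) (hε : 0 < ε) : inner ℝ η w ≤ ε * ‖w‖ := by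
      have hc : Tendsto (fun t : ℝ => t • w) (𝓝[>] 0) (𝓝 0) := by
        simpa using (tendsto_id.smul_const w).mono_left (nhdsWithin_le_nhds (a := (0 : ℝ)))
      obtain ⟨t, ht, ht0⟩ := ((hc.eventually (hη ε hε)).and self_mem_nhdsWithin).exists
      have := ht (hcone t ht0 w hw)
      rw [real_inner_smul_right, norm_smul, Real.norm_of_nonneg (le_of_lt ht0),
        mul_left_comm] at this
      exact le_of_mul_le_mul_left this ht0
    rw [real_inner_comm]
    exact nonpos_of_forall_le_mul hle
  · rw [real_inner_comm]
    exact (h w hw).trans (by positivity)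

theorem mem_limNormalCone_of_eventually {xk ηk : ℕ → E} (hx : x ∈ Q)
    (hxk : Tendsto xk atTop (𝓝 x)) (hηk : Tendsto ηk atTop (𝓝 η))
    (h : ∀ᶠ k in atTop, ηk k ∈ regNormalCone Q (xk k)) : η ∈ limNormalCone Q x := by
  obtain ⟨N, hN⟩ := eventually_atTop.1 h
  have hshift := tendsto_add_atTop_nat N
  exact ⟨hx, _, _, hxk.comp hshift, hηk.comp hshift, fun k => hN _ (Nat.le_add_left N k)⟩

theorem mem_dirNormalCone_of_eventually {d : E} {dk ηk : ℕ → E} {t : ℕ → ℝ}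
    (hd : Tendsto dk atTop (𝓝 d)) (ht : ∀ k, 0 < t k) (ht0 : Tendsto t atTop (𝓝 0))
    (hη : Tendsto ηk atTop (𝓝 η))
    (h : ∀ᶠ k in atTop, ηk k ∈ regNormalCone Q (x + t k • dk k)) : η ∈ dirNormalCone Q x d := by
  obtain ⟨N, hN⟩ := eventually_atTop.1 h
  have hshift := tendsto_add_atTop_nat N
  exact ⟨_, _, _, hd.comp hshift, fun k => ht _, ht0.comp hshift, hη.comp hshift,
    fun k => hN _ (Nat.le_add_left N k)⟩

/-- `Q` coincides near `p` with `p + T`, where `T` is a cone (closed under positive scaling). The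
tangents and normals to `Q` at and around `p` are then those to `T`. -/
structure HasConicGerm (Q : Set E) (p : E) (T : Set E) : Prop where
  smul_mem : ∀ t : ℝ, 0 < t → ∀ w ∈ T, t • w ∈ T
  eventually_iff : ∀ᶠ w in 𝓝 0, p + w ∈ Q ↔ w ∈ T

namespace HasConicGerm

variable {T : Set E} {p : E}

theorem smul_mem_iff (h : HasConicGerm Q p T) {t : ℝ} (ht : 0 < t) {w : E} :
    t • w ∈ T ↔ w ∈ T :=
  ⟨fun hw => by simpa [ht.ne'] using h.smul_mem t⁻¹ (inv_pos.2 ht) _ hw, h.smul_mem t ht w⟩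

theorem zero_mem (h : HasConicGerm Q p T) (hp : p ∈ Q) : (0 : E) ∈ T :=
  h.eventually_iff.self_of_nhds.1 (by simpa using hp)

theorem tangentCone_eq (h : HasConicGerm Q p T) (hT : IsClosed T) (hp : p ∈ Q) :
    tangentCone Q p = T := by
  ext d
  constructor
  · rintro ⟨-, dk, t, hd, ht, ht0, hQ⟩
    have hlim : Tendsto (fun k => t k • dk k) atTop (𝓝 0) := by simpa using ht0.smul hd
    refine hT.mem_of_tendsto hd ?_
    filter_upwards [hlim.eventually h.eventually_iff] with k hk
    exact (h.smul_mem_iff (ht k)).1 (hk.1 (hQ k))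
  · intro hd
    have hlim : Tendsto (fun t : ℝ => t • d) (𝓝[>] 0) (𝓝 0) := by
      simpa using (tendsto_id.smul_const d).mono_left (nhdsWithin_le_nhds (a := (0 : ℝ)))
    refine mem_tangentCone_of_eventually hp ?_
    filter_upwards [hlim.eventually h.eventually_iff, self_mem_nhdsWithin] with t ht ht0
    exact ht.2 (h.smul_mem t ht0 d hd)

theorem regNormalCone_eq (h : HasConicGerm Q p T) (hp : p ∈ Q) :
    regNormalCone Q p = polarCone T := by
  rw [← regNormalCone_zero_eq_polarCone (h.zero_mem hp) h.smul_mem]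
  exact regNormalCone_eq_of_eventually one_pos (by simpa using h.eventually_iff)

theorem eventually_regNormalCone_eq (h : HasConicGerm Q p T) {d : ℕ → E} {t : ℕ → ℝ}
    (ht : ∀ k, 0 < t k) (htd : Tendsto (fun k => t k • d k) atTop (𝓝 0)) :
    ∀ᶠ k in atTop, regNormalCone Q (p + t k • d k) = regNormalCone T (d k) := by
  filter_upwards [htd.eventually h.eventually_iff.eventually_nhds] with k hk
  refine regNormalCone_eq_of_eventually (ht k) ?_
  have hlim : Tendsto (fun w => t k • (d k + w)) (𝓝 0) (𝓝 (t k • d k)) := by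
    have : Continuous fun w => t k • (d k + w) := by fun_prop
    simpa using this.tendsto 0
  filter_upwards [hlim.eventually hk] with w hw
  rw [add_assoc, ← smul_add, hw, h.smul_mem_iff (ht k)]

theorem dirNormalCone_eq (h : HasConicGerm Q p T) (hT : IsClosed T) (d : E) :
    dirNormalCone Q p d = limNormalCone T d := by
  ext η
  constructor
  · rintro ⟨dk, t, ηk, hd, ht, ht0, hη, hN⟩
    have hNT : ∀ᶠ k in atTop, ηk k ∈ regNormalCone T (dk k) :=
      (h.eventually_regNormalCone_eq ht (by simpa using ht0.smul hd)).mono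
        fun k hk => hk ▸ hN k
    exact mem_limNormalCone_of_eventually (hT.mem_of_tendsto hd (hNT.mono fun _ hk => hk.1))
      hd hη hNT
  · rintro ⟨-, dk, ηk, hd, hη, hN⟩
    have ht (k : ℕ) : (0 : ℝ) < 1 / ((k : ℝ) + 1) := by positivity
    have ht0 := tendsto_one_div_add_atTop_nhds_zero_nat (𝕜 := ℝ)
    exact mem_dirNormalCone_of_eventually hd ht ht0 hη
      ((h.eventually_regNormalCone_eq ht (by simpa using ht0.smul hd)).mono
        fun k hk => hk ▸ hN k)

end HasConicGerm

end TangentNormalCones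

section Polyhedral

variable {E : Type*} [NormedAddCommGroup E] [InnerProductSpace ℝ E]

theorem eventually_inner_add_le_iff (a e : E) (c : ℝ) :
    ∀ᶠ w in 𝓝 (0 : E), inner ℝ a (e + w) ≤ c ↔
      inner ℝ a e < c ∨ inner ℝ a e = c ∧ inner ℝ a w ≤ 0 := by
  have hlim : Tendsto (fun w : E => inner ℝ a (e + w)) (𝓝 0) (𝓝 (inner ℝ a e)) := by
    have : Continuous fun w : E => inner ℝ a (e + w) := by fun_prop
    simpa using this.tendsto 0
  rcases lt_trichotomy (inner ℝ a e) c with h | h | h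
  · filter_upwards [hlim.eventually_lt_const h] with w hw
    simp [hw.le, h]
  · exact .of_forall fun w => by simp [inner_add_right, h]
  · filter_upwards [hlim.eventually_const_lt h] with w hw
    simp [hw.not_ge, h.not_gt, h.ne']

/-- Polyhedral cones, in general not convex: the union of the convex cones
`{w | ∀ a ∈ A, ⟪a, w⟫ ≤ 0}`, `A ∈ 𝓐`. -/
def polyhedralCone (𝓐 : Finset (Finset E)) : Set E :=
  ⋃ A ∈ 𝓐, polarCone (A : Set E)

variable {𝓐 : Finset (Finset E)}

theorem mem_polyhedralCone {w : E} :
    w ∈ polyhedralCone 𝓐 ↔ ∃ A ∈ 𝓐, ∀ a ∈ A, inner ℝ a w ≤ 0 := by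
  simp [polyhedralCone, mem_polarCone]

theorem isClosed_polyhedralCone : IsClosed (polyhedralCone 𝓐) :=
  𝓐.finite_toSet.isClosed_biUnion fun _ _ => isClosed_polarCone _

theorem isPolyhedral_polyhedralCone : IsPolyhedral (polyhedralCone 𝓐) := by
  classical
  refine ⟨(fun A : Finset E => (polarCone (A : Set E) : Set E)) '' 𝓐, 𝓐.finite_toSet.image _, ?_,
    by simp [polyhedralCone, Set.sUnion_image]⟩
  rintro _ ⟨A, -, rfl⟩
  exact ⟨A.image fun a => (a, 0), by ext; simp [mem_polarCone]⟩

theorem hasConicGerm_polyhedralCone_iff {Q : Set E} {p : E} :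
    HasConicGerm Q p (polyhedralCone 𝓐) ↔
      ∀ᶠ w in 𝓝 0, p + w ∈ Q ↔ ∃ A ∈ 𝓐, ∀ a ∈ A, inner ℝ a w ≤ 0 := by
  simp only [← mem_polyhedralCone]
  refine ⟨fun h => h.eventually_iff, fun h => ⟨fun t ht w hw => ?_, h⟩⟩
  simp only [polyhedralCone, Set.mem_iUnion₂] at hw ⊢
  exact hw.imp fun A => .imp fun _ hwA => (polarCone _).smul_mem ht.le hwA

theorem IsConvexPolyhedral.exists_hasConicGerm {P : Set E} (hP : IsConvexPolyhedral P) (p : E) :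
    ∃ 𝓐, HasConicGerm P p (polyhedralCone 𝓐) := by
  classical
  obtain ⟨H, rfl⟩ := hP
  have hloc : ∀ᶠ w in 𝓝 (0 : E), ∀ h ∈ H, inner ℝ h.1 (p + w) ≤ h.2 ↔
      inner ℝ h.1 p < h.2 ∨ inner ℝ h.1 p = h.2 ∧ inner ℝ h.1 w ≤ 0 :=
    (Finset.eventually_all H).2 fun h _ => eventually_inner_add_le_iff h.1 p h.2
  by_cases hp : ∀ h ∈ H, inner ℝ h.1 p ≤ h.2
  · refine ⟨{{h ∈ H | inner ℝ h.1 p = h.2}.image Prod.fst}, hasConicGerm_polyhedralCone_iff.2 ?_⟩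
    filter_upwards [hloc] with w hw
    simp only [Finset.mem_singleton, exists_eq_left, Finset.forall_mem_image, Finset.mem_filter,
      and_imp]
    refine forall₂_congr fun h hh => ?_
    rw [hw h hh]
    rcases (hp h hh).lt_or_eq with hlt | heq
    · simp [hlt, hlt.ne]
    · simp [heq]
  · refine ⟨∅, hasConicGerm_polyhedralCone_iff.2 ?_⟩
    push Not at hp
    obtain ⟨h, hh, hlt⟩ := hp
    filter_upwards [hloc] with w hw
    simp only [Finset.notMem_empty, false_and, exists_false, iff_false]
    intro hPw
    rcases (hw h hh).1 (hPw h hh) with h' | h'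
    · exact h'.not_gt hlt
    · exact h'.1.not_gt hlt

theorem IsPolyhedral.exists_hasConicGerm {Q : Set E} (hQ : IsPolyhedral Q) (p : E) :
    ∃ 𝓐, HasConicGerm Q p (polyhedralCone 𝓐) := by
  classical
  obtain ⟨S, hS, hP, rfl⟩ := hQ
  induction S, hS using Set.Finite.induction_on with
  | empty => exact ⟨∅, hasConicGerm_polyhedralCone_iff.2 (by simp)⟩
  | @insert P S _ _ ih =>
    obtain ⟨𝓑, h𝓑⟩ := (hP P (Set.mem_insert _ _)).exists_hasConicGerm p
    obtain ⟨𝓒, h𝓒⟩ := ih fun P' hP' => hP P' (Set.mem_insert_of_mem _ hP')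
    rw [hasConicGerm_polyhedralCone_iff] at h𝓑 h𝓒
    refine ⟨𝓑 ∪ 𝓒, hasConicGerm_polyhedralCone_iff.2 ?_⟩
    filter_upwards [h𝓑, h𝓒] with w hw𝓑 hw𝓒
    rw [Set.sUnion_insert, Set.mem_union, hw𝓑, hw𝓒]
    simp only [Finset.mem_union, or_and_right, exists_or]

theorem IsLocallyPolyhedral.exists_hasConicGerm {m : ℕ} {D : Set (EuclideanSpace ℝ (Fin m))}
    {p : EuclideanSpace ℝ (Fin m)} (hD : IsLocallyPolyhedral D p) :
    ∃ 𝓐, HasConicGerm D p (polyhedralCone 𝓐) := by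
  obtain ⟨ε, hε, hpoly⟩ := hD
  obtain ⟨𝓐, h𝓐⟩ := hpoly.exists_hasConicGerm p
  refine ⟨𝓐, h𝓐.smul_mem, ?_⟩
  filter_upwards [h𝓐.eventually_iff, Metric.ball_mem_nhds _ hε] with w hw hwε
  rw [mem_ball_zero_iff] at hwε
  have hbox (i : Fin m) : |(p + w) i - p i| ≤ ε := by
    simpa using (PiLp.norm_apply_le w i).trans hwε.le
  rw [← hw]
  exact ⟨fun h => ⟨h, hbox⟩, fun h => h.1⟩

theorem fg_polarCone_polyhedralCone [FiniteDimensional ℝ E] :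
    (polarCone (polyhedralCone 𝓐)).FG := by
  classical
  refine fg_of_dualFG_neg_innerₗ ?_
  induction 𝓐 using Finset.induction with
  | empty => simp [polyhedralCone, polarCone]
  | insert A 𝓐 _ ih =>
    have hunion : polyhedralCone (insert A 𝓐) =
        (polarCone (A : Set E) : Set E) ∪ polyhedralCone 𝓐 :=
      Finset.set_biUnion_insert _ _ _
    rw [hunion, polarCone, PointedCone.dual_union]
    exact (PointedCone.DualFG.dual_of_fg _ (fg_polarCone A.finite_toSet)).inf ih

theorem exists_fg_eq_regNormalCone_polyhedralCone [FiniteDimensional ℝ E] {e : E}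
    (he : e ∈ polyhedralCone 𝓐) :
    ∃ K : PointedCone ℝ E, K.FG ∧ (K : Set E) = regNormalCone (polyhedralCone 𝓐) e := by
  obtain ⟨𝓑, h𝓑⟩ := (isPolyhedral_polyhedralCone (𝓐 := 𝓐)).exists_hasConicGerm e
  exact ⟨_, fg_polarCone_polyhedralCone, (h𝓑.regNormalCone_eq he).symm⟩

/-- The functionals `a` among `± ⋃ 𝓐` with `⟪a, e⟫ ≤ 0`; these record the cell of `e` in the
arrangement of the hyperplanes `aᗮ`, and the closure of this cell is their polar cone. -/
def signPattern (𝓐 : Finset (Finset E)) (e : E) : Set E :=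
  {a | (∃ A ∈ 𝓐, a ∈ A ∨ -a ∈ A) ∧ inner ℝ a e ≤ 0}

theorem finite_setOf_mem_or_neg_mem {G : Type*} [InvolutiveNeg G] (𝓐 : Finset (Finset G)) :
    {a : G | ∃ A ∈ 𝓐, a ∈ A ∨ -a ∈ A}.Finite := by
  have : {a : G | ∃ A ∈ 𝓐, a ∈ A ∨ -a ∈ A} = ⋃ A ∈ 𝓐, ((A : Set G) ∪ -(A : Set G)) := by
    ext; simp
  rw [this]
  exact 𝓐.finite_toSet.biUnion fun A _ => A.finite_toSet.union A.finite_toSet.neg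

theorem finite_signPattern (e : E) : (signPattern 𝓐 e).Finite :=
  (finite_setOf_mem_or_neg_mem 𝓐).subset fun _ ha => ha.1

theorem finite_range_signPattern : (Set.range (signPattern 𝓐)).Finite :=
  (finite_setOf_mem_or_neg_mem 𝓐).finite_subsets.subset <| by
    rintro _ ⟨e, rfl⟩
    exact fun _ ha => ha.1

theorem mem_polarCone_signPattern (e : E) : e ∈ polarCone (signPattern 𝓐 e) :=
  mem_polarCone.2 fun _ ha => ha.2

theorem signPattern_eq_iff {e e' : E} : signPattern 𝓐 e = signPattern 𝓐 e' ↔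
    ∀ A ∈ 𝓐, ∀ a ∈ A, (inner ℝ a e ≤ 0 ↔ inner ℝ a e' ≤ 0) ∧
      (0 ≤ inner ℝ a e ↔ 0 ≤ inner ℝ a e') := by
  constructor
  · intro h A hA a ha
    have hpos := Set.ext_iff.1 h a
    have hneg := Set.ext_iff.1 h (-a)
    simp only [signPattern, Set.mem_ofPred_eq, inner_neg_left, neg_nonpos, neg_neg] at hpos hneg
    exact ⟨by simpa [show ∃ A ∈ 𝓐, a ∈ A ∨ -a ∈ A from ⟨A, hA, .inl ha⟩] using hpos,
      by simpa [show ∃ A ∈ 𝓐, -a ∈ A ∨ a ∈ A from ⟨A, hA, .inr ha⟩] using hneg⟩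
  · intro h
    ext a
    refine and_congr_right ?_
    rintro ⟨A, hA, ha | ha⟩
    · exact (h A hA a ha).1
    · simpa using (h A hA _ ha).2

theorem regNormalCone_polyhedralCone_congr {e e' : E}
    (h : signPattern 𝓐 e = signPattern 𝓐 e') :
    regNormalCone (polyhedralCone 𝓐) e = regNormalCone (polyhedralCone 𝓐) e' := by
  have hloc (e : E) : ∀ᶠ w in 𝓝 (0 : E), ∀ A ∈ 𝓐, ∀ a ∈ A, inner ℝ a (e + w) ≤ 0 ↔
      inner ℝ a e < 0 ∨ inner ℝ a e = 0 ∧ inner ℝ a w ≤ 0 :=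
    (Finset.eventually_all 𝓐).2 fun A _ => (Finset.eventually_all A).2 fun a _ =>
      eventually_inner_add_le_iff a e 0
  refine regNormalCone_eq_of_eventually one_pos ?_
  filter_upwards [hloc e, hloc e'] with w hw hw'
  simp only [one_smul, mem_polyhedralCone]
  refine exists_congr fun A => and_congr_right fun hA => forall₂_congr fun a ha => ?_
  obtain ⟨hle, hge⟩ := signPattern_eq_iff.1 h A hA a ha
  rw [hw A hA a ha, hw' A hA a ha, lt_iff_not_ge, lt_iff_not_ge, hge, le_antisymm_iff,
    le_antisymm_iff, hle, hge]

theorem signPattern_add_smul_eq {e e' : E} (he' : e' ∈ polarCone (signPattern 𝓐 e)) {t : ℝ}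
    (ht : 0 < t) (ht1 : t ≤ 1) : signPattern 𝓐 (e' + t • (e - e')) = signPattern 𝓐 e := by
  have hcell : ∀ a : E, (∃ A ∈ 𝓐, a ∈ A ∨ -a ∈ A) → inner ℝ a e ≤ 0 → inner ℝ a e' ≤ 0 :=
    fun a ha hae => mem_polarCone.1 he' a ⟨ha, hae⟩
  have hval (a : E) :
      inner ℝ a (e' + t • (e - e')) = (1 - t) * inner ℝ a e' + t * inner ℝ a e := by
    simp only [inner_add_right, real_inner_smul_right, inner_sub_right]
    ring
  refine signPattern_eq_iff.2 fun A hA a ha => ?_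
  have hpos := hcell a ⟨A, hA, .inl ha⟩
  have hneg := hcell (-a) ⟨A, hA, .inr (by simpa using ha)⟩
  simp only [inner_neg_left, neg_nonpos] at hneg
  rw [hval]
  have hs := sub_nonneg.2 ht1
  constructor
  · refine ⟨fun h => ?_, fun h => ?_⟩
    · by_contra! hlt
      nlinarith [mul_nonneg hs (hneg hlt.le)]
    · nlinarith [mul_nonneg hs (neg_nonneg.2 (hpos h))]
  · refine ⟨fun h => ?_, fun h => ?_⟩
    · by_contra! hlt
      nlinarith [mul_nonneg hs (neg_nonneg.2 (hpos hlt.le))]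
    · nlinarith [mul_nonneg hs (hneg h)]

/-- The half-open segment from `e` to a point `e'` of the closure of its cell stays in the cell. -/
theorem regNormalCone_subset_limNormalCone_of_mem_polarCone {e e' : E}
    (he' : e' ∈ polarCone (signPattern 𝓐 e)) :
    regNormalCone (polyhedralCone 𝓐) e ⊆ limNormalCone (polyhedralCone 𝓐) e' := by
  intro η hη
  have ht (k : ℕ) : (0 : ℝ) < 1 / ((k : ℝ) + 1) := by positivity
  have ht1 (k : ℕ) : 1 / ((k : ℝ) + 1) ≤ 1 := by
    rw [div_le_one (by positivity)]
    linarith [Nat.cast_nonneg (α := ℝ) k]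
  have hN (k : ℕ) : η ∈ regNormalCone (polyhedralCone 𝓐) (e' + (1 / ((k : ℝ) + 1)) • (e - e')) := by
    rwa [regNormalCone_polyhedralCone_congr (signPattern_add_smul_eq he' (ht k) (ht1 k))]
  have hx : Tendsto (fun k : ℕ => e' + (1 / ((k : ℝ) + 1)) • (e - e')) atTop (𝓝 e') := by
    simpa using tendsto_const_nhds.add
      ((tendsto_one_div_add_atTop_nhds_zero_nat (𝕜 := ℝ)).smul_const (e - e'))
  exact ⟨isClosed_polyhedralCone.mem_of_tendsto hx (.of_forall fun k => (hN k).1), _, _, hx,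
    tendsto_const_nhds, hN⟩

end Polyhedral

section PolyhedralLimit

variable {E : Type*} [NormedAddCommGroup E] [InnerProductSpace ℝ E]

theorem exists_strictMono_forall_eq_and {α : Type*} {f : ℕ → α} (hf : (Set.range f).Finite)
    {p : ℕ → Prop} (hp : ∀ᶠ k in atTop, p k) :
    ∃ a, ∃ φ : ℕ → ℕ, StrictMono φ ∧ ∀ k, f (φ k) = a ∧ p (φ k) := by
  have := hf.to_subtype
  obtain ⟨a, ha⟩ := Finite.exists_infinite_fiber (Set.rangeFactorization f)
  obtain ⟨φ, hφ, hφa⟩ := extraction_of_frequently_atTop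
    ((Nat.frequently_atTop_iff_infinite.2 (Set.infinite_coe_iff.1 ha)).and_eventually hp)
  exact ⟨a, φ, hφ, fun k => ⟨congrArg Subtype.val (hφa k).1, (hφa k).2⟩⟩

theorem mem_tangentCone_of_mem_sup_hull_neg {K : PointedCone ℝ E} {y z : E} (hy : y ∈ K)
    (hz : z ∈ K ⊔ PointedCone.hull ℝ {-y}) : z ∈ tangentCone (K : Set E) y := by
  obtain ⟨r, -, hzr⟩ := mem_sup_hull_singleton_iff.1 hz
  refine mem_tangentCone_of_eventually hy ?_
  have hlim : Tendsto (fun t : ℝ => t * r) (𝓝[>] 0) (𝓝 0) := by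
    simpa using (tendsto_id.mul_const r).mono_left (nhdsWithin_le_nhds (a := (0 : ℝ)))
  filter_upwards [self_mem_nhdsWithin, hlim.eventually (gt_mem_nhds one_pos)] with t ht htr
  have hsplit : y + t • z = t • (z - r • -y) + (1 - t * r) • y := by module
  rw [hsplit]
  exact add_mem (K.smul_mem (le_of_lt ht) hzr) (K.smul_mem (sub_nonneg.2 htr.le) hy)

variable {F : Type*} [NormedAddCommGroup F] [InnerProductSpace ℝ F] [FiniteDimensional ℝ E]
  [FiniteDimensional ℝ F]

/-- The image of `K + ℝ₊ (-y)` under `A` is a finitely generated, hence closed, cone. -/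
theorem exists_mem_tangentCone_of_tendsto {K : PointedCone ℝ E} (hK : K.FG) {η : ℕ → E} {y : E}
    (hη : ∀ k, η k ∈ K) (hy : Tendsto η atTop (𝓝 y)) {c : ℕ → ℝ} (hc : ∀ k, 0 ≤ c k)
    {A : E →L[ℝ] F} {b : F} (hA : Tendsto (fun k => A (c k • (η k - y))) atTop (𝓝 b)) :
    ∃ z ∈ tangentCone (K : Set E) y, A z = b := by
  have hyK : y ∈ K := (isClosed_of_fg hK).mem_of_tendsto hy (.of_forall hη)
  have hmem (k : ℕ) : c k • (η k - y) ∈ K ⊔ PointedCone.hull ℝ {-y} :=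
    mem_sup_hull_singleton_iff.2 ⟨c k, hc k, by
      convert K.smul_mem (hc k) (hη k) using 1
      module⟩
  have hclosed := isClosed_image_of_fg (hK.sup (Submodule.fg_span_singleton (-y))) A
  obtain ⟨z, hz, hzb⟩ := hclosed.mem_of_tendsto hA (.of_forall fun k => ⟨_, hmem k, rfl⟩)
  exact ⟨z, mem_tangentCone_of_mem_sup_hull_neg hyK hz, hzb⟩

/-- Along a subsequence all `e k` lie in one cell, so that the normals lie in one finitely generated
cone. -/
theorem exists_mem_tangentCone_limNormalCone_polyhedralCone {G : Type*} [AddCommGroup G]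
    [Module ℝ G] {𝓐 : Finset (Finset E)} {e η : ℕ → E} {y : E}
    (hη : ∀ᶠ k in atTop, η k ∈ regNormalCone (polyhedralCone 𝓐) (e k))
    (hy : Tendsto η atTop (𝓝 y)) {c : ℕ → ℝ} (hc : ∀ k, 0 ≤ c k) {A : E →L[ℝ] F} {b : F}
    (hA : Tendsto (fun k => A (c k • (η k - y))) atTop (𝓝 b)) {B : G →ₗ[ℝ] E} {s : ℕ → G} {w : E}
    (hB : Tendsto (fun k => e k - B (s k)) atTop (𝓝 w)) :
    ∃ s', ∃ z ∈ tangentCone (limNormalCone (polyhedralCone 𝓐) (w + B s')) y, A z = b := by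
  obtain ⟨_, φ, hφ, hcell⟩ := exists_strictMono_forall_eq_and
    (finite_range_signPattern.subset (Set.range_comp_subset_range e (signPattern 𝓐))) hη
  have hpattern (k : ℕ) : signPattern 𝓐 (e (φ k)) = signPattern 𝓐 (e (φ 0)) :=
    (hcell k).1.trans (hcell 0).1.symm
  have hη' (k : ℕ) : η (φ k) ∈ regNormalCone (polyhedralCone 𝓐) (e (φ 0)) :=
    regNormalCone_polyhedralCone_congr (hpattern k) ▸ (hcell k).2
  have hφ_lim := hφ.tendsto_atTop
  obtain ⟨K, hK, hK_eq⟩ := exists_fg_eq_regNormalCone_polyhedralCone (hη' 0).1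
  obtain ⟨z, hz, hzb⟩ := exists_mem_tangentCone_of_tendsto hK
    (fun k => SetLike.mem_coe.1 (hK_eq ▸ hη' k)) (hy.comp hφ_lim) (fun k => hc (φ k))
    (hA.comp hφ_lim)
  obtain ⟨_, ⟨s', rfl⟩, hs'⟩ := exists_add_mem_of_tendsto_sub (V := LinearMap.range B)
    (fg_polarCone (finite_signPattern (e (φ 0))))
    (fun k => hpattern k ▸ mem_polarCone_signPattern (e (φ k)))
    (fun k => ⟨s (φ k), rfl⟩) (hB.comp hφ_lim)
  refine ⟨s', z, tangentCone_mono ?_ hz, hzb⟩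
  rw [hK_eq]
  exact regNormalCone_subset_limNormalCone_of_mem_polarCone hs'

end PolyhedralLimit

section SecondOrderCalculus

variable {X Y : Type*} [NormedAddCommGroup X] [NormedSpace ℝ X] [NormedAddCommGroup Y]
  [NormedSpace ℝ Y]

/-- `g` is differentiable near `x` and its derivative is differentiable at `x`, so that `g` has a
second-order Taylor expansion at `x`. -/
def TwiceDifferentiableAt (g : X → Y) (x : X) : Prop :=
  (∀ᶠ x' in 𝓝 x, DifferentiableAt ℝ g x') ∧ DifferentiableAt ℝ (fderiv ℝ g) x

theorem twiceDifferentiableAt_of_contDiff {g : X → Y} (hg : ContDiff ℝ 2 g) (x : X) :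
    TwiceDifferentiableAt g x :=
  ⟨.of_forall (hg.differentiable (by norm_num)),
    (hg.fderiv_right (m := 1) (by norm_num)).differentiable (by norm_num) x⟩

theorem tendsto_clm_apply {ι : Type*} {l : Filter ι} {S : ι → X →L[ℝ] Y} {S' : X →L[ℝ] Y}
    {x : ι → X} {x' : X} (hS : Tendsto S l (𝓝 S')) (hx : Tendsto x l (𝓝 x')) :
    Tendsto (fun i => S i (x i)) l (𝓝 (S' x')) :=
  (isBoundedBilinearMap_apply.continuous.tendsto (S', x')).comp (hS.prodMk_nhds hx)

theorem tendsto_add_smul {x u : X} {uk : ℕ → X} {t : ℕ → ℝ} (ht0 : Tendsto t atTop (𝓝 0))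
    (hu : Tendsto uk atTop (𝓝 u)) : Tendsto (fun k => x + t k • uk k) atTop (𝓝 x) := by
  simpa using (ht0.smul hu).const_add x

theorem tendsto_inv_smul_sub {f : X → Y} {f' : X →L[ℝ] Y} {x u : X} (hf : HasFDerivAt f f' x)
    {uk : ℕ → X} {t : ℕ → ℝ} (hu : Tendsto uk atTop (𝓝 u)) (ht : ∀ k, 0 < t k)
    (ht0 : Tendsto t atTop (𝓝 0)) :
    Tendsto (fun k => (t k)⁻¹ • (f (x + t k • uk k) - f x)) atTop (𝓝 (f' u)) :=
  hf.hasFDerivWithinAt.lim (by simpa using ht0.smul hu) (.of_forall fun _ => Set.mem_univ _)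
    (by simpa [smul_smul, inv_mul_cancel₀ (ht _).ne'] using hu)

theorem norm_sub_sub_sub_half_smul_le {g : X → Y} {x h : X} {T : X →L[ℝ] X →L[ℝ] Y} {ε : ℝ}
    (hg : ∀ s ∈ Set.Icc (0 : ℝ) 1, DifferentiableAt ℝ g (x + s • h))
    (hε : ∀ s ∈ Set.Ico (0 : ℝ) 1,
      ‖fderiv ℝ g (x + s • h) - fderiv ℝ g x - T (s • h)‖ ≤ ε * ‖h‖) :
    ‖g (x + h) - g x - fderiv ℝ g x h - (1 / 2 : ℝ) • T h h‖ ≤ ε * ‖h‖ ^ 2 := by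
  have hderiv (s : ℝ) (hs : s ∈ Set.Icc (0 : ℝ) 1) :
      HasDerivAt (fun s : ℝ => g (x + s • h) - s • fderiv ℝ g x h - (s ^ 2 / 2) • T h h)
        ((fderiv ℝ g (x + s • h) - fderiv ℝ g x - T (s • h)) h) s := by
    have hline : HasDerivAt (fun s : ℝ => x + s • h) h s := by
      simpa using ((hasDerivAt_id s).smul_const h).const_add x
    have hlin : HasDerivAt (fun s : ℝ => s • fderiv ℝ g x h) (fderiv ℝ g x h) s := by
      simpa using (hasDerivAt_id s).smul_const (fderiv ℝ g x h)
    have hsq : HasDerivAt (fun s : ℝ => s ^ 2 / 2) s s := by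
      simpa using (hasDerivAt_pow 2 s).div_const 2
    refine HasDerivAt.congr_deriv ((((hg s hs).hasFDerivAt.comp_hasDerivAt s hline).sub hlin).sub
      (hsq.smul_const (T h h))) ?_
    simp
  have hbound (s : ℝ) (hs : s ∈ Set.Ico (0 : ℝ) 1) :
      ‖(fderiv ℝ g (x + s • h) - fderiv ℝ g x - T (s • h)) h‖ ≤ ε * ‖h‖ ^ 2 := by
    rw [pow_two, ← mul_assoc]
    exact ContinuousLinearMap.le_of_opNorm_le _ (hε s hs) h
  have hmean := norm_image_sub_le_of_norm_deriv_le_segment_01'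
    (fun s hs => (hderiv s hs).hasDerivWithinAt) hbound
  convert hmean using 2
  simp only [one_smul, zero_smul, add_zero, one_pow, sub_zero, ne_eq, OfNat.ofNat_ne_zero,
    not_false_eq_true, zero_pow, zero_div]
  abel

theorem isLittleO_sub_sub_sub_half_smul {g : X → Y} {x : X} (hg : TwiceDifferentiableAt g x) :
    (fun h => g (x + h) - g x - fderiv ℝ g x h - (1 / 2 : ℝ) • fderiv ℝ (fderiv ℝ g) x h h)
      =o[𝓝 0] fun h => ‖h‖ ^ 2 := by
  have hdiff : ∀ᶠ h in 𝓝 (0 : X), DifferentiableAt ℝ g (x + h) := by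
    have hadd : Tendsto (fun h => x + h) (𝓝 0) (𝓝 x) := by
      simpa using (continuous_const_add x).tendsto 0
    exact hadd.eventually hg.1
  have hlittle := hasFDerivAt_iff_isLittleO_nhds_zero.1 hg.2.hasFDerivAt
  refine Asymptotics.isLittleO_iff.2 fun ε hε => ?_
  obtain ⟨r, hr, hball⟩ := Metric.eventually_nhds_iff_ball.1
    (hdiff.and (Asymptotics.isLittleO_iff.1 hlittle hε))
  filter_upwards [Metric.ball_mem_nhds (0 : X) hr] with h hh
  have hsmul (s : ℝ) (hs : s ∈ Set.Icc (0 : ℝ) 1) : ‖s • h‖ ≤ ‖h‖ := by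
    rw [norm_smul, Real.norm_of_nonneg hs.1]
    exact mul_le_of_le_one_left (norm_nonneg h) hs.2
  have hmem (s : ℝ) (hs : s ∈ Set.Icc (0 : ℝ) 1) : s • h ∈ Metric.ball (0 : X) r := by
    rw [mem_ball_zero_iff] at hh ⊢
    exact (hsmul s hs).trans_lt hh
  rw [norm_pow, norm_norm]
  refine norm_sub_sub_sub_half_smul_le (fun s hs => (hball _ (hmem s hs)).1) fun s hs => ?_
  have hs' := Set.Ico_subset_Icc_self hs
  exact (hball _ (hmem s hs')).2.trans (mul_le_mul_of_nonneg_left (hsmul s hs') hε.le)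

theorem tendsto_second_order_quotient {g : X → Y} {x u : X} (hg : TwiceDifferentiableAt g x)
    {uk : ℕ → X} {t : ℕ → ℝ} (hu : Tendsto uk atTop (𝓝 u)) (ht : ∀ k, 0 < t k)
    (ht0 : Tendsto t atTop (𝓝 0)) :
    Tendsto (fun k => (t k ^ 2)⁻¹ • (g (x + t k • uk k) - g x - t k • fderiv ℝ g x (uk k)))
      atTop (𝓝 ((1 / 2 : ℝ) • fderiv ℝ (fderiv ℝ g) x u u)) := by
  have htu : Tendsto (fun k => t k • uk k) atTop (𝓝 0) := by simpa using ht0.smul hu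
  have hbigO : (fun k => ‖t k • uk k‖ ^ 2) =O[atTop] fun k => t k ^ 2 := by
    refine (Asymptotics.IsBigO.norm_left ?_).pow 2
    simpa using (Asymptotics.isBigO_refl t atTop).smul (hu.isBigO_one ℝ)
  have hremainder := (((isLittleO_sub_sub_sub_half_smul hg).comp_tendsto htu).trans_isBigO
    hbigO).tendsto_inv_smul_nhds_zero
  have hquadratic := (tendsto_clm_apply (tendsto_clm_apply
    (tendsto_const_nhds (x := fderiv ℝ (fderiv ℝ g) x)) hu) hu).const_smul (1 / 2 : ℝ)
  have hsum := hremainder.add hquadratic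
  rw [zero_add] at hsum
  refine hsum.congr fun k => ?_
  have hsplit : (t k ^ 2)⁻¹ • (1 / 2 : ℝ) • fderiv ℝ (fderiv ℝ g) x (t k • uk k) (t k • uk k) =
      (1 / 2 : ℝ) • fderiv ℝ (fderiv ℝ g) x (uk k) (uk k) := by
    have := (ht k).ne'
    simp only [map_smul, smul_apply, smul_smul]
    congr 1
    field_simp
  rw [Function.comp_apply, smul_sub _ (_ - _ - _), hsplit, sub_add_cancel, map_smul]

end SecondOrderCalculus

section Scalarization

variable {X Y : Type*} [NormedAddCommGroup X] [InnerProductSpace ℝ X] [FiniteDimensional ℝ X]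
  [NormedAddCommGroup Y] [InnerProductSpace ℝ Y] [FiniteDimensional ℝ Y]

theorem gradient_inner_comp {g : X → Y} {x : X} (hg : DifferentiableAt ℝ g x) (y : Y) :
    gradient (fun x' => (inner ℝ y (g x') : ℝ)) x = adjDeriv g x y := by
  refine HasGradientAt.gradient (hasGradientAt_iff_hasFDerivAt.2 ?_)
  refine ((innerSL ℝ y).hasFDerivAt.comp x hg.hasFDerivAt).congr_fderiv ?_
  ext h
  simp [adjDeriv, ContinuousLinearMap.adjoint_inner_left]

theorem scalarHess_eq {g : X → Y} {x : X} (hg : TwiceDifferentiableAt g x) (y : Y) (u : X) :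
    scalarHess y g x u = ContinuousLinearMap.adjoint (fderiv ℝ (fderiv ℝ g) x u) y := by
  let adjointApply : (X →L[ℝ] Y) →L[ℝ] X := LinearMap.toContinuousLinearMap
    { toFun := fun T => ContinuousLinearMap.adjoint T y
      map_add' := fun S T => by simp
      map_smul' := fun r T => by simp }
  have hgrad : gradient (fun x' => (inner ℝ y (g x') : ℝ)) =ᶠ[𝓝 x]
      fun x' => adjointApply (fderiv ℝ g x') :=
    hg.1.mono fun x' hx' => gradient_inner_comp hx' y
  rw [scalarHess, hgrad.fderiv_eq]
  exact congrArg (fun T : X →L[ℝ] X => T u)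
    (adjointApply.hasFDerivAt.comp x hg.2.hasFDerivAt).fderiv

theorem secondDeriv_eq {m : ℕ} {g : X → EuclideanSpace ℝ (Fin m)} {x : X}
    (hg : TwiceDifferentiableAt g x) (u : X) :
    secondDeriv g x u = fderiv ℝ (fderiv ℝ g) x u u := by
  ext i
  simp [secondDeriv, scalarHess_eq hg, ContinuousLinearMap.adjoint_inner_right,
    Pi.single_apply, EuclideanSpace.inner_single_right]

theorem tendsto_adjDeriv {g : X → Y} {x : X} (hg : ContinuousAt (fderiv ℝ g) x) {xk : ℕ → X}
    {yk : ℕ → Y} {y : Y} (hx : Tendsto xk atTop (𝓝 x)) (hy : Tendsto yk atTop (𝓝 y)) :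
    Tendsto (fun k => adjDeriv g (xk k) (yk k)) atTop (𝓝 (adjDeriv g x y)) :=
  tendsto_clm_apply ((ContinuousLinearMap.adjoint.continuous.tendsto _).comp
    (hg.tendsto.comp hx)) hy

theorem tendsto_inv_smul_adjDeriv_sub {g : X → Y} {x u : X} (hg : TwiceDifferentiableAt g x)
    {uk : ℕ → X} {yk : ℕ → Y} {y : Y} {t : ℕ → ℝ} (hu : Tendsto uk atTop (𝓝 u))
    (hy : Tendsto yk atTop (𝓝 y)) (ht : ∀ k, 0 < t k) (ht0 : Tendsto t atTop (𝓝 0)) :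
    Tendsto (fun k => (t k)⁻¹ • (adjDeriv g (x + t k • uk k) (yk k) - adjDeriv g x (yk k)))
      atTop (𝓝 (scalarHess y g x u)) := by
  rw [scalarHess_eq hg]
  refine (tendsto_clm_apply ((ContinuousLinearMap.adjoint.continuous.tendsto _).comp
    (tendsto_inv_smul_sub hg.2.hasFDerivAt hu ht ht0)) hy).congr fun k => ?_
  simp [adjDeriv]

theorem adjDeriv_eq_zero_of_tendsto {g : X → Y} {x u xs : X} {ys : Y}
    (hg : ContinuousAt (fderiv ℝ g) x) {uk : ℕ → X} {ysk : ℕ → Y} {t : ℕ → ℝ}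
    (hu : Tendsto uk atTop (𝓝 u)) (hys : Tendsto ysk atTop (𝓝 ys)) (ht : ∀ k, 0 < t k)
    (ht0 : Tendsto t atTop (𝓝 0))
    (hxs : Tendsto (fun k => (t k)⁻¹ • adjDeriv g (x + t k • uk k) (ysk k)) atTop (𝓝 xs)) :
    adjDeriv g x ys = 0 := by
  refine tendsto_nhds_unique (tendsto_adjDeriv hg (tendsto_add_smul ht0 hu) hys) ?_
  have hscaled := ht0.smul hxs
  rw [zero_smul] at hscaled
  exact hscaled.congr fun k => smul_inv_smul₀ (ht k).ne' _

theorem tendsto_adjDeriv_quotient {g : X → Y} {x u xs : X} {ys : Y}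
    (hg : TwiceDifferentiableAt g x) {uk : ℕ → X} {ysk : ℕ → Y} {t : ℕ → ℝ}
    (hu : Tendsto uk atTop (𝓝 u)) (hys : Tendsto ysk atTop (𝓝 ys)) (ht : ∀ k, 0 < t k)
    (ht0 : Tendsto t atTop (𝓝 0))
    (hxs : Tendsto (fun k => (t k)⁻¹ • adjDeriv g (x + t k • uk k) (ysk k)) atTop (𝓝 xs)) :
    Tendsto (fun k => adjDeriv g x ((t k)⁻¹ • (ysk k - ys))) atTop
      (𝓝 (xs - scalarHess ys g x u)) := by
  have hker := adjDeriv_eq_zero_of_tendsto hg.2.continuousAt hu hys ht ht0 hxs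
  refine (hxs.sub (tendsto_inv_smul_adjDeriv_sub hg hu hys ht ht0)).congr fun k => ?_
  rw [← smul_sub, sub_sub_cancel, map_smul, map_sub, hker, sub_zero]

end Scalarization

section ConstraintMapping

theorem mem_constraintMap_iff {X Y : Type*} [NormedAddCommGroup Y] {g : X → Y} {D : Set Y} {x : X}
    {w : Y} : w ∈ constraintMap g D x ↔ g x - w ∈ D := by
  constructor
  · rintro ⟨d, hd, rfl⟩
    rwa [sub_sub_cancel]
  · exact fun h => ⟨_, h, (sub_sub_cancel _ _).symm⟩

variable {X Y : Type*} [NormedAddCommGroup X] [InnerProductSpace ℝ X] [NormedAddCommGroup Y]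
  [InnerProductSpace ℝ Y] {g : X → Y} {D : Set Y} {x a : X} {w b : Y}

theorem inner_nonpos_of_mem_regNormalCone {Q : Set X} {p η d : X} (hη : η ∈ regNormalCone Q p)
    (hd : d ∈ tangentCone Q p) : (inner ℝ η d : ℝ) ≤ 0 := by
  obtain ⟨-, dk, t, hdk, ht, ht0, hQ⟩ := hd
  have hlimit (ε : ℝ) (hε : 0 < ε) : (inner ℝ η d : ℝ) ≤ ε * ‖d‖ := by
    have hp : Tendsto (fun k => p + t k • dk k) atTop (𝓝[Q] p) :=
      tendsto_nhdsWithin_iff.2 ⟨tendsto_add_smul ht0 hdk, .of_forall hQ⟩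
    refine le_of_tendsto_of_tendsto (tendsto_const_nhds.inner hdk) (hdk.norm.const_mul ε) ?_
    filter_upwards [hp.eventually (hη.2 ε hε)] with k hk
    rw [add_sub_cancel_left, real_inner_smul_right, norm_smul, Real.norm_of_nonneg (ht k).le,
      mul_left_comm] at hk
    exact le_of_mul_le_mul_left hk (ht k)
  exact nonpos_of_forall_le_mul hlimit

theorem mem_tangentCone_gph_constraintMap (hg : DifferentiableAt ℝ g x)
    (hw : g x - w ∈ D) (h : X) :
    WithLp.toLp 2 (h, fderiv ℝ g x h) ∈
      tangentCone (gph (constraintMap g D)) (WithLp.toLp 2 (x, w)) := by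
  have ht (k : ℕ) : (0 : ℝ) < 1 / ((k : ℝ) + 1) := by positivity
  have ht0 := tendsto_one_div_add_atTop_nhds_zero_nat (𝕜 := ℝ)
  refine ⟨mem_constraintMap_iff.2 hw, _, _,
    ((WithLp.prod_continuous_toLp 2 X Y).tendsto _).comp (tendsto_const_nhds.prodMk_nhds
      (tendsto_inv_smul_sub hg.hasFDerivAt tendsto_const_nhds ht ht0)), ht, ht0, fun k => ?_⟩
  rw [Function.comp_apply, ← WithLp.toLp_smul, ← WithLp.toLp_add,
    Prod.smul_mk, Prod.mk_add_mk, smul_inv_smul₀ (ht k).ne']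
  refine ⟨g x - w, hw, ?_⟩
  change w + (g (x + _ • h) - g x) = g (x + _ • h) - (g x - w)
  abel

theorem neg_mem_regNormalCone_of_mem_regNormalCone_gph
    (h : WithLp.toLp 2 (a, b) ∈ regNormalCone (gph (constraintMap g D)) (WithLp.toLp 2 (x, w))) :
    -b ∈ regNormalCone D (g x - w) := by
  refine ⟨mem_constraintMap_iff.1 h.1, fun ε hε => ?_⟩
  have hfiber : Tendsto (fun d => WithLp.toLp 2 (x, g x - d)) (𝓝[D] (g x - w))
      (𝓝[gph (constraintMap g D)] (WithLp.toLp 2 (x, w))) := by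
    refine tendsto_nhdsWithin_iff.2 ⟨?_, ?_⟩
    · have hcont : Continuous fun d => WithLp.toLp 2 (x, g x - d) :=
        (WithLp.prod_continuous_toLp 2 X Y).comp (by fun_prop)
      simpa using (hcont.tendsto (g x - w)).mono_left nhdsWithin_le_nhds
    · filter_upwards [self_mem_nhdsWithin] with d hd
      exact ⟨d, hd, rfl⟩
  filter_upwards [hfiber.eventually (h.2 ε hε)] with d hd
  have hsub : WithLp.toLp 2 (x, g x - d) - WithLp.toLp 2 (x, w) =
      WithLp.toLp 2 ((0 : X), -(d - (g x - w))) := by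
    rw [← WithLp.toLp_sub, Prod.mk_sub_mk, sub_self]
    congr 2
    abel
  have hnorm : ‖WithLp.toLp 2 ((0 : X), -(d - (g x - w)))‖ = ‖d - (g x - w)‖ := by
    rw [WithLp.norm_toLp_snd, norm_neg]
  rw [hsub, hnorm, WithLp.prod_inner_apply, inner_zero_right, zero_add, inner_neg_right] at hd
  rwa [inner_neg_left]

variable [FiniteDimensional ℝ X] [FiniteDimensional ℝ Y]

theorem eq_neg_adjDeriv_of_mem_regNormalCone_gph (hg : DifferentiableAt ℝ g x)
    (h : WithLp.toLp 2 (a, b) ∈ regNormalCone (gph (constraintMap g D)) (WithLp.toLp 2 (x, w))) :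
    a = -adjDeriv g x b := by
  have hnonpos (e : X) : (inner ℝ a e + inner ℝ b (fderiv ℝ g x e) : ℝ) ≤ 0 := by
    simpa [WithLp.prod_inner_apply] using inner_nonpos_of_mem_regNormalCone h
      (mem_tangentCone_gph_constraintMap hg (mem_constraintMap_iff.1 h.1) e)
  refine ext_inner_right ℝ fun e => ?_
  have hneg := hnonpos (-e)
  rw [map_neg, inner_neg_right, inner_neg_right] at hneg
  rw [inner_neg_left, adjDeriv, ContinuousLinearMap.adjoint_inner_left]
  linarith [hnonpos e]

theorem normal_relations_of_mem_regNormalCone_gph {r : ℝ} {y : Y} (hg : DifferentiableAt ℝ g x)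
    (hr : 0 < r) (h : WithLp.toLp 2 (a, -(r⁻¹ • y)) ∈
      regNormalCone (gph (constraintMap g D)) (WithLp.toLp 2 (x, w))) :
    r • a = adjDeriv g x y ∧ y ∈ regNormalCone D (g x - w) := by
  have hmem := smul_mem_regNormalCone hr (neg_mem_regNormalCone_of_mem_regNormalCone_gph h)
  rw [neg_neg, smul_inv_smul₀ hr.ne'] at hmem
  refine ⟨?_, hmem⟩
  rw [eq_neg_adjDeriv_of_mem_regNormalCone_gph hg h, map_neg, neg_neg, map_smul,
    smul_inv_smul₀ hr.ne']

/-- Both pseudo-coderivatives of order 2 are given by normals to the graph of this form; they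
differ only in the points `w k`. -/
theorem eventually_normal_relations {u xs : X} (hg : ∀ᶠ x' in 𝓝 x, DifferentiableAt ℝ g x')
    (hu1 : ‖u‖ = 1) {uk xsk : ℕ → X} {ysk w : ℕ → Y} {t : ℕ → ℝ} (hu : Tendsto uk atTop (𝓝 u))
    (ht : ∀ k, 0 < t k) (ht0 : Tendsto t atTop (𝓝 0)) (hxs : Tendsto xsk atTop (𝓝 xs))
    (h : ∀ k, WithLp.toLp 2 (xsk k, -(((t k * ‖uk k‖) ^ ((2 : ℝ) - 1))⁻¹ • ysk k)) ∈
      regNormalCone (gph (constraintMap g D)) (WithLp.toLp 2 (x + t k • uk k, w k))) :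
    (∀ᶠ k in atTop, ysk k ∈ regNormalCone D (g (x + t k • uk k) - w k)) ∧
      Tendsto (fun k => (t k)⁻¹ • adjDeriv g (x + t k • uk k) (ysk k)) atTop (𝓝 xs) := by
  have hnorm : Tendsto (fun k => ‖uk k‖) atTop (𝓝 1) := hu1 ▸ hu.norm
  have hrelations : ∀ᶠ k in atTop, (t k * ‖uk k‖) • xsk k = adjDeriv g (x + t k • uk k) (ysk k) ∧
      ysk k ∈ regNormalCone D (g (x + t k • uk k) - w k) := by
    filter_upwards [(tendsto_add_smul ht0 hu).eventually hg,
      hnorm.eventually_const_lt one_pos] with k hk huk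
    have hNk := h k
    rw [show (2 : ℝ) - 1 = 1 by norm_num, Real.rpow_one] at hNk
    exact normal_relations_of_mem_regNormalCone_gph hk (mul_pos (ht k) huk) hNk
  refine ⟨hrelations.mono fun _ hk => hk.2, ?_⟩
  have hscaled := hnorm.smul hxs
  rw [one_smul] at hscaled
  refine hscaled.congr' (hrelations.mono fun k hk => ?_)
  beta_reduce
  rw [← hk.1, mul_smul, inv_smul_smul₀ (ht k).ne']

end ConstraintMapping

section Normalization

variable {F : Type*} [NormedAddCommGroup F] [NormedSpace ℝ F]

theorem norm_eq_one_of_tendsto_normalized {q : ℕ → F} {z : F} (hq : ∀ k, q k ≠ 0)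
    (hz : Tendsto (fun k => ‖q k‖⁻¹ • q k) atTop (𝓝 z)) : ‖z‖ = 1 :=
  tendsto_nhds_unique hz.norm
    (tendsto_const_nhds.congr fun k => (norm_smul_inv_norm (𝕜 := ℝ) (hq k)).symm)

theorem exists_tendsto_subseq_or_tendsto_norm_atTop {F : Type*} [NormedAddCommGroup F]
    [ProperSpace F] (z : ℕ → F) :
    (∃ (a : F) (φ : ℕ → ℕ), StrictMono φ ∧ Tendsto (z ∘ φ) atTop (𝓝 a)) ∨
      Tendsto (fun k => ‖z k‖) atTop atTop := by
  by_cases hbounded : ∃ R, ∃ᶠ k in atTop, ‖z k‖ ≤ R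
  · obtain ⟨R, hR⟩ := hbounded
    obtain ⟨a, -, φ, hφ, hz⟩ := tendsto_subseq_of_frequently_bounded
      (Metric.isBounded_closedBall (x := (0 : F)) (r := R))
      (hR.mono fun k hk => mem_closedBall_zero_iff.2 hk)
    exact .inl ⟨a, φ, hφ, hz⟩
  · push Not at hbounded
    exact .inr (tendsto_atTop.2 fun R => (hbounded R).mono fun k hk => hk.le)

theorem exists_tendsto_normalized_subseq [ProperSpace F] {q : ℕ → F}
    (hq : ∀ᶠ k in atTop, q k ≠ 0) :
    ∃ (z : F) (φ : ℕ → ℕ), StrictMono φ ∧ (∀ k, q (φ k) ≠ 0) ∧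
      Tendsto (fun k => ‖q (φ k)‖⁻¹ • q (φ k)) atTop (𝓝 z) := by
  obtain ⟨ψ, hψ, hψ0⟩ := extraction_of_eventually_atTop hq
  obtain ⟨z, -, φ, hφ, hz⟩ := (isCompact_sphere (0 : F) 1).tendsto_subseq
    (x := fun k => ‖q (ψ k)‖⁻¹ • q (ψ k))
    fun k => mem_sphere_zero_iff_norm.2 (norm_smul_inv_norm (𝕜 := ℝ) (hψ0 k))
  exact ⟨z, ψ ∘ φ, hψ.comp hφ, fun k => hψ0 _, hz⟩

end Normalization

section GraphicalDerivatives

variable {E F : Type*} [NormedAddCommGroup E] [InnerProductSpace ℝ E] [NormedAddCommGroup F]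
  [InnerProductSpace ℝ F] {S : E → Set F} {p d : E} {y z : F} {dk : ℕ → E} {yk : ℕ → F}
  {t : ℕ → ℝ}

theorem mem_graphicalDeriv_of_tendsto (hpy : y ∈ S p) (hd : Tendsto dk atTop (𝓝 d))
    (ht : ∀ k, 0 < t k) (ht0 : Tendsto t atTop (𝓝 0)) (hS : ∀ k, yk k ∈ S (p + t k • dk k))
    (hz : Tendsto (fun k => (t k)⁻¹ • (yk k - y)) atTop (𝓝 z)) : z ∈ graphicalDeriv S p y d := by
  refine ⟨hpy, _, t,
    ((WithLp.prod_continuous_toLp 2 E F).tendsto _).comp (hd.prodMk_nhds hz), ht, ht0, fun k => ?_⟩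
  change y + t k • (t k)⁻¹ • (yk k - y) ∈ S (p + t k • dk k)
  rw [smul_inv_smul₀ (ht k).ne', add_sub_cancel]
  exact hS k

theorem mem_graphicalDeriv_zero_of_tendsto_normalized (hpy : y ∈ S p)
    (hd : Tendsto dk atTop (𝓝 d)) (hy : Tendsto yk atTop (𝓝 y)) (hne : ∀ k, yk k - y ≠ 0)
    (hratio : Tendsto (fun k => ‖yk k - y‖ / t k) atTop atTop)
    (hS : ∀ k, yk k ∈ S (p + t k • dk k))
    (hz : Tendsto (fun k => ‖yk k - y‖⁻¹ • (yk k - y)) atTop (𝓝 z)) :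
    z ∈ graphicalDeriv S p y 0 := by
  have hdir : Tendsto (fun k => (‖yk k - y‖ / t k)⁻¹ • dk k) atTop (𝓝 0) := by
    simpa using hratio.inv_tendsto_atTop.smul hd
  have hy0 : Tendsto (fun k => ‖yk k - y‖) atTop (𝓝 0) := by simpa using (hy.sub_const y).norm
  refine mem_graphicalDeriv_of_tendsto hpy hdir (fun k => norm_pos_iff.2 (hne k)) hy0
    (fun k => ?_) hz
  rw [inv_div, smul_smul, mul_div_cancel₀ _ (norm_ne_zero_iff.2 (hne k))]
  exact hS k

theorem mem_graphicalSubderiv_of_tendsto_normalized (hd0 : d ≠ 0) (hd : Tendsto dk atTop (𝓝 d))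
    (ht : ∀ k, 0 < t k) (ht0 : Tendsto t atTop (𝓝 0)) (hy : Tendsto yk atTop (𝓝 y))
    (hne : ∀ k, yk k - y ≠ 0) (hratio : Tendsto (fun k => ‖yk k - y‖ / t k) atTop atTop)
    (hS : ∀ k, yk k ∈ S (p + t k • dk k))
    (hz : Tendsto (fun k => ‖yk k - y‖⁻¹ • (yk k - y)) atTop (𝓝 z)) :
    z ∈ graphicalSubderiv S p y (‖d‖⁻¹ • d) := by
  have hnorm : 0 < ‖d‖ := norm_pos_iff.2 hd0
  refine ⟨norm_eq_one_of_tendsto_normalized hne hz, _, _, fun k => t k * ‖d‖,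
    fun k => ‖yk k - y‖, hd.const_smul _, hz, fun k => mul_pos (ht k) hnorm,
    by simpa using ht0.mul_const ‖d‖, fun k => norm_pos_iff.2 (hne k),
    by simpa using (hy.sub_const y).norm, ?_, fun k => ?_⟩
  · exact (hratio.atTop_div_const hnorm).congr fun k => div_div _ _ _
  · change y + ‖yk k - y‖ • ‖yk k - y‖⁻¹ • (yk k - y) ∈ S (p + (t k * ‖d‖) • ‖d‖⁻¹ • dk k)
    rw [smul_inv_smul₀ (norm_ne_zero_iff.2 (hne k)), add_sub_cancel, mul_smul,
      smul_inv_smul₀ hnorm.ne']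
    exact hS k

/-- The alternatives are whether or not the difference quotients of `yk` have a bounded
subsequence. -/
theorem exists_mem_graphicalDeriv_or {W : Type*} [NormedAddCommGroup W] [NormedSpace ℝ W]
    [FiniteDimensional ℝ F] (hpy : y ∈ S p) (hd : Tendsto dk atTop (𝓝 d)) (ht : ∀ k, 0 < t k)
    (ht0 : Tendsto t atTop (𝓝 0)) (hy : Tendsto yk atTop (𝓝 y))
    (hS : ∀ k, yk k ∈ S (p + t k • dk k)) (A : F →L[ℝ] W) {b : W}
    (hA : Tendsto (fun k => A ((t k)⁻¹ • (yk k - y))) atTop (𝓝 b)) :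
    (∃ z ∈ graphicalDeriv S p y d, A z = b) ∨
      ∃ z, ‖z‖ = 1 ∧ A z = 0 ∧ z ∈ graphicalDeriv S p y 0 ∧
        (d ≠ 0 → z ∈ graphicalSubderiv S p y (‖d‖⁻¹ • d)) := by
  rcases exists_tendsto_subseq_or_tendsto_norm_atTop fun k => (t k)⁻¹ • (yk k - y) with
    ⟨z, φ, hφ, hz⟩ | hunbounded
  · have hφ' := hφ.tendsto_atTop
    exact .inl ⟨z, mem_graphicalDeriv_of_tendsto hpy (hd.comp hφ') (fun k => ht _)
      (ht0.comp hφ') (fun k => hS _) hz,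
      tendsto_nhds_unique ((A.continuous.tendsto z).comp hz) (hA.comp hφ')⟩
  · have hratio : Tendsto (fun k => ‖yk k - y‖ / t k) atTop atTop := hunbounded.congr fun k => by
      rw [norm_smul, norm_inv, Real.norm_of_nonneg (ht k).le, inv_mul_eq_div]
    have hne : ∀ᶠ k in atTop, yk k - y ≠ 0 := (hratio.eventually_gt_atTop 0).mono
      fun k hk h0 => by simp [h0] at hk
    have hA0 : Tendsto (fun k => A (‖yk k - y‖⁻¹ • (yk k - y))) atTop (𝓝 0) := by
      have hscaled := hratio.inv_tendsto_atTop.smul hA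
      rw [zero_smul] at hscaled
      refine hscaled.congr fun k => ?_
      rw [Pi.inv_apply, inv_div, ← map_smul, smul_smul, div_mul_eq_mul_div,
        mul_inv_cancel₀ (ht k).ne', one_div]
    obtain ⟨z, φ, hφ, hφne, hz⟩ := exists_tendsto_normalized_subseq hne
    have hφ' := hφ.tendsto_atTop
    refine .inr ⟨z, norm_eq_one_of_tendsto_normalized hφne hz,
      tendsto_nhds_unique ((A.continuous.tendsto z).comp hz) (hA0.comp hφ'), ?_, fun hd0 => ?_⟩
    · exact mem_graphicalDeriv_zero_of_tendsto_normalized hpy (hd.comp hφ') (hy.comp hφ') hφne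
        (hratio.comp hφ') (fun k => hS _) hz
    · exact mem_graphicalSubderiv_of_tendsto_normalized hd0 (hd.comp hφ') (fun k => ht _)
        (ht0.comp hφ') (hy.comp hφ') hφne (hratio.comp hφ') (fun k => hS _) hz

end GraphicalDerivatives

section Multipliers

variable {X Y : Type*} [NormedAddCommGroup X] [InnerProductSpace ℝ X] [FiniteDimensional ℝ X]
  [NormedAddCommGroup Y] [InnerProductSpace ℝ Y] [FiniteDimensional ℝ Y] {g : X → Y} {D : Set Y}
  {x u xs : X} {v ys : Y}

theorem regNormalCone_subset_limNormalCone {E : Type*} [NormedAddCommGroup E]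
    [InnerProductSpace ℝ E] (Q : Set E) (p : E) : regNormalCone Q p ⊆ limNormalCone Q p :=
  fun _ h => ⟨h.1, _, _, tendsto_const_nhds, tendsto_const_nhds, fun _ => h⟩

theorem exists_normal_seq_of_mem_gfrererPseudoCoderiv (hg : TwiceDifferentiableAt g x)
    (hu1 : ‖u‖ = 1) (h : xs ∈ gfrererPseudoCoderiv 2 (constraintMap g D) x 0 u v ys) :
    ∃ (dk ysk : ℕ → Y) (t : ℕ → ℝ), Tendsto dk atTop (𝓝 (fderiv ℝ g x u - v)) ∧
      (∀ k, 0 < t k) ∧ Tendsto t atTop (𝓝 0) ∧ Tendsto ysk atTop (𝓝 ys) ∧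
      (∀ k, ysk k ∈ regNormalCone D (g x + t k • dk k)) ∧ adjDeriv g x ys = 0 ∧
      Tendsto (fun k => adjDeriv g x ((t k)⁻¹ • (ysk k - ys))) atTop
        (𝓝 (xs - scalarHess ys g x u)) := by
  obtain ⟨uk, xsk, vk, ysk, t, hu, hv, ht, ht0, hxs, hys, hN⟩ := h
  obtain ⟨hnormal, hquot⟩ := eventually_normal_relations hg.1 hu1 hu ht ht0 hxs hN
  have hd := (tendsto_inv_smul_sub hg.1.self_of_nhds.hasFDerivAt hu ht ht0).sub hv
  obtain ⟨N, hnormal⟩ := eventually_atTop.1 hnormal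
  have hshift := tendsto_add_atTop_nat N
  refine ⟨_, _, _, hd.comp hshift, fun k => ht _, ht0.comp hshift, hys.comp hshift, fun k => ?_,
    adjDeriv_eq_zero_of_tendsto hg.2.continuousAt hu hys ht ht0 hquot,
    (tendsto_adjDeriv_quotient hg hu hys ht ht0 hquot).comp hshift⟩
  rw [Function.comp_apply, Function.comp_apply, smul_sub, smul_inv_smul₀ (ht _).ne',
    ← add_sub_assoc, add_sub_cancel, ← zero_add (t _ • vk _)]
  exact hnormal _ (Nat.le_add_left N k)

theorem exists_normal_seq_of_mem_pseudoCoderiv (hg : TwiceDifferentiableAt g x)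
    (hu1 : ‖u‖ = 1) (h : xs ∈ pseudoCoderiv 2 (constraintMap g D) x 0 u v ys) :
    ∃ (ek ysk : ℕ → Y) (sk : ℕ → X) (t : ℕ → ℝ), (∀ k, 0 < t k) ∧ Tendsto t atTop (𝓝 0) ∧
      Tendsto (fun k => t k • ek k) atTop (𝓝 0) ∧
      Tendsto (fun k => ek k - fderiv ℝ g x (sk k)) atTop
        (𝓝 ((1 / 2 : ℝ) • fderiv ℝ (fderiv ℝ g) x u u - v)) ∧ Tendsto ysk atTop (𝓝 ys) ∧
      (∀ᶠ k in atTop, ysk k ∈ regNormalCone D (g x + t k • (fderiv ℝ g x u + t k • ek k))) ∧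
      adjDeriv g x ys = 0 ∧
      Tendsto (fun k => adjDeriv g x ((t k)⁻¹ • (ysk k - ys))) atTop
        (𝓝 (xs - scalarHess ys g x u)) := by
  obtain ⟨uk, xsk, vk, ysk, t, hu, hv, ht, ht0, hxs, hys, hN⟩ := h
  obtain ⟨hnormal, hquot⟩ := eventually_normal_relations hg.1 hu1 hu ht ht0 hxs hN
  have hnorm : Tendsto (fun k => ‖uk k‖) atTop (𝓝 1) := hu1 ▸ hu.norm
  have hv' : Tendsto (fun k => ‖uk k‖ ^ 2 • vk k) atTop (𝓝 v) := by
    simpa using (hnorm.pow 2).smul hv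
  have hd := (tendsto_inv_smul_sub hg.1.self_of_nhds.hasFDerivAt hu ht ht0).sub_const
    (fderiv ℝ g x u)
  refine ⟨fun k => (t k ^ 2)⁻¹ • (g (x + t k • uk k) - g x - t k • fderiv ℝ g x u) -
      ‖uk k‖ ^ 2 • vk k, ysk, fun k => (t k)⁻¹ • (uk k - u), t, ht, ht0, ?_, ?_, hys, ?_,
    adjDeriv_eq_zero_of_tendsto hg.2.continuousAt hu hys ht ht0 hquot,
    tendsto_adjDeriv_quotient hg hu hys ht ht0 hquot⟩
  · have hsum := hd.sub (ht0.smul hv')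
    rw [sub_self, zero_smul, sub_zero] at hsum
    refine hsum.congr fun k => ?_
    have := (ht k).ne'
    match_scalars <;> field_simp
  · refine ((tendsto_second_order_quotient hg hu ht ht0).sub hv').congr fun k => ?_
    have := (ht k).ne'
    rw [map_smul, map_sub]
    match_scalars <;> field_simp
    ring
  · filter_upwards [hnormal] with k hk
    convert hk using 2
    have := (ht k).ne'
    rw [Real.rpow_two]
    match_scalars <;> field_simp <;> ring

theorem mem_dirNormalCone_inter_kerAdjDeriv (hg : TwiceDifferentiableAt g x) (hu1 : ‖u‖ = 1)
    (h : xs ∈ gfrererPseudoCoderiv 2 (constraintMap g D) x 0 u v ys) :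
    ys ∈ dirNormalCone D (g x) (fderiv ℝ g x u - v) ∩ kerAdjDeriv g x := by
  obtain ⟨dk, ysk, t, hd, ht, ht0, hys, hN, hker, -⟩ :=
    exists_normal_seq_of_mem_gfrererPseudoCoderiv hg hu1 h
  exact ⟨⟨dk, t, ysk, hd, ht, ht0, hys, hN⟩, hker⟩

theorem exists_inner_eq_zero_multiplier (hg : TwiceDifferentiableAt g x) (hu1 : ‖u‖ = 1)
    (h : xs ∈ gfrererPseudoCoderiv 2 (constraintMap g D) x 0 u v ys) :
    ∃ zs : Y, inner ℝ ys zs = 0 ∧ xs = scalarHess ys g x u + adjDeriv g x zs := by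
  obtain ⟨_, _, _, -, -, -, -, -, hker, hquot⟩ :=
    exists_normal_seq_of_mem_gfrererPseudoCoderiv hg hu1 h
  have hclosed : IsClosed (Set.range (adjDeriv g x)) :=
    (LinearMap.range (adjDeriv g x : Y →ₗ[ℝ] X)).closed_of_finiteDimensional
  obtain ⟨z, hz⟩ := hclosed.mem_of_tendsto hquot (.of_forall fun k => ⟨_, rfl⟩)
  refine ⟨z - ((inner ℝ ys z : ℝ) / ‖ys‖ ^ 2) • ys, ?_, ?_⟩
  · rw [inner_sub_right, real_inner_smul_right, real_inner_self_eq_norm_sq]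
    rcases eq_or_ne ys 0 with rfl | h0
    · simp
    · rw [div_mul_cancel₀ _ (by simpa using h0), sub_self]
  · rw [map_sub, map_smul, hker, smul_zero, sub_zero, hz, add_sub_cancel]

theorem exists_graphicalDeriv_multiplier (hg : TwiceDifferentiableAt g x) (hx : g x ∈ D)
    (hu1 : ‖u‖ = 1) (h : xs ∈ gfrererPseudoCoderiv 2 (constraintMap g D) x 0 u v ys)
    (hreg : graphicalDeriv (limNormalCone D) (g x) ys 0 ∩ kerAdjDeriv g x = {0} ∨
      (fderiv ℝ g x u ≠ v ∧ graphicalSubderiv (limNormalCone D) (g x) ys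
        (‖fderiv ℝ g x u - v‖⁻¹ • (fderiv ℝ g x u - v)) ∩ kerAdjDeriv g x = ∅)) :
    ∃ zs ∈ graphicalDeriv (limNormalCone D) (g x) ys (fderiv ℝ g x u - v),
      xs = scalarHess ys g x u + adjDeriv g x zs := by
  obtain ⟨dk, ysk, t, hd, ht, ht0, hys, hN, -, hquot⟩ :=
    exists_normal_seq_of_mem_gfrererPseudoCoderiv hg hu1 h
  have hlim : ys ∈ limNormalCone D (g x) := ⟨hx, _, ysk, tendsto_add_smul ht0 hd, hys, hN⟩
  rcases exists_mem_graphicalDeriv_or hlim hd ht ht0 hys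
    (fun k => regNormalCone_subset_limNormalCone _ _ (hN k)) (adjDeriv g x) hquot with
    ⟨z, hz, hAz⟩ | ⟨z, hz1, hAz, hz0, hzsub⟩
  · exact ⟨z, hz, by rw [hAz, add_sub_cancel]⟩
  · rcases hreg with hreg | ⟨hne, hreg⟩
    · have hzero : z = 0 := hreg.subset ⟨hz0, hAz⟩
      simp [hzero] at hz1
    · exact (hreg.subset ⟨hzsub (sub_ne_zero.2 hne), hAz⟩).elim

variable {𝓐 : Finset (Finset Y)}

theorem exists_polyhedral_multiplier (hg : TwiceDifferentiableAt g x) (hx : g x ∈ D)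
    (hu1 : ‖u‖ = 1) (hD : HasConicGerm D (g x) (polyhedralCone 𝓐))
    (h : xs ∈ gfrererPseudoCoderiv 2 (constraintMap g D) x 0 u v ys) :
    ∃ zs ∈ tangentCone (limNormalCone (tangentCone D (g x)) (fderiv ℝ g x u - v)) ys,
      xs = scalarHess ys g x u + adjDeriv g x zs := by
  obtain ⟨dk, ysk, t, hd, ht, ht0, hys, hN, -, hquot⟩ :=
    exists_normal_seq_of_mem_gfrererPseudoCoderiv hg hu1 h
  have hNT : ∀ᶠ k in atTop, ysk k ∈ regNormalCone (polyhedralCone 𝓐) (dk k) :=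
    (hD.eventually_regNormalCone_eq ht (by simpa using ht0.smul hd)).mono
      fun k hk => hk ▸ hN k
  obtain ⟨s, z, hz, hAz⟩ := exists_mem_tangentCone_limNormalCone_polyhedralCone hNT hys
    (fun k => (inv_pos.2 (ht k)).le) hquot (B := (0 : Y →ₗ[ℝ] Y)) (s := 0) (by simpa using hd)
  rw [LinearMap.zero_apply, add_zero] at hz
  rw [hD.tangentCone_eq isClosed_polyhedralCone hx]
  exact ⟨z, hz, by rw [hAz, add_sub_cancel]⟩

theorem exists_second_order_polyhedral_multiplier (hg : TwiceDifferentiableAt g x)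
    (hx : g x ∈ D) (hu1 : ‖u‖ = 1) (hD : HasConicGerm D (g x) (polyhedralCone 𝓐))
    (h : xs ∈ pseudoCoderiv 2 (constraintMap g D) x 0 u v ys) :
    ∃ s, ∃ zs ∈ tangentCone (limNormalCone (tangentCone (tangentCone D (g x)) (fderiv ℝ g x u))
        (fderiv ℝ g x s + (1 / 2 : ℝ) • fderiv ℝ (fderiv ℝ g) x u u - v)) ys,
      xs = scalarHess ys g x u + adjDeriv g x zs ∧ adjDeriv g x ys = 0 := by
  obtain ⟨ek, ysk, sk, t, ht, ht0, hte, hes, hys, hN, hker, hquot⟩ :=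
    exists_normal_seq_of_mem_pseudoCoderiv hg hu1 h
  have hd : Tendsto (fun k => fderiv ℝ g x u + t k • ek k) atTop (𝓝 (fderiv ℝ g x u)) := by
    simpa using hte.const_add (fderiv ℝ g x u)
  have hNT : ∀ᶠ k in atTop,
      ysk k ∈ regNormalCone (polyhedralCone 𝓐) (fderiv ℝ g x u + t k • ek k) := by
    filter_upwards [hN, hD.eventually_regNormalCone_eq ht
      (by simpa only [zero_smul] using ht0.smul hd)] with k hk hcone
    exact hcone ▸ hk
  have hu𝓐 : fderiv ℝ g x u ∈ polyhedralCone 𝓐 :=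
    isClosed_polyhedralCone.mem_of_tendsto hd (hNT.mono fun _ hk => hk.1)
  obtain ⟨𝓑, h𝓑⟩ := isPolyhedral_polyhedralCone.exists_hasConicGerm (fderiv ℝ g x u)
  have hNTT : ∀ᶠ k in atTop, ysk k ∈ regNormalCone (polyhedralCone 𝓑) (ek k) := by
    filter_upwards [hNT, h𝓑.eventually_regNormalCone_eq ht hte] with k hk hcone
    exact hcone ▸ hk
  obtain ⟨s, z, hz, hAz⟩ := exists_mem_tangentCone_limNormalCone_polyhedralCone hNTT hys
    (fun k => (inv_pos.2 (ht k)).le) hquot (B := (fderiv ℝ g x : X →ₗ[ℝ] Y)) hes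
  rw [hD.tangentCone_eq isClosed_polyhedralCone hx,
    h𝓑.tangentCone_eq isClosed_polyhedralCone hu𝓐]
  refine ⟨s, z, ?_, by rw [hAz, add_sub_cancel], hker⟩
  rwa [add_sub_assoc, add_comm]

end Multipliers

end VarAnalysis

theorem theorem3p2_general {X : Type*} [NormedAddCommGroup X] [InnerProductSpace ℝ X]
    [FiniteDimensional ℝ X] :
    (∀ (Y : Type*) [NormedAddCommGroup Y] [InnerProductSpace ℝ Y] [FiniteDimensional ℝ Y]
      (g : X → Y) (D : Set Y) (xbar u : X),
      TwiceDifferentiableAt g xbar → (0 : Y) ∈ constraintMap g D xbar → ‖u‖ = 1 →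
      ∀ (v ys : Y) (xs : X),
        xs ∈ gfrererPseudoCoderiv 2 (constraintMap g D) xbar 0 u v ys →
        (∃ zs : Y, inner ℝ ys zs = 0 ∧
          xs = scalarHess ys g xbar u + adjDeriv g xbar zs ∧
          ys ∈ dirNormalCone D (g xbar) (fderiv ℝ g xbar u - v) ∩ kerAdjDeriv g xbar) ∧
        ((graphicalDeriv (limNormalCone D) (g xbar) ys 0 ∩ kerAdjDeriv g xbar = {0} ∨
          (fderiv ℝ g xbar u ≠ v ∧
            graphicalSubderiv (limNormalCone D) (g xbar) ys
              (‖fderiv ℝ g xbar u - v‖⁻¹ • (fderiv ℝ g xbar u - v)) ∩ kerAdjDeriv g xbar = ∅)) →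
          ∃ zs ∈ graphicalDeriv (limNormalCone D) (g xbar) ys (fderiv ℝ g xbar u - v),
            xs = scalarHess ys g xbar u + adjDeriv g xbar zs ∧
            ys ∈ dirNormalCone D (g xbar) (fderiv ℝ g xbar u - v) ∩ kerAdjDeriv g xbar)) ∧
    (∀ (m : ℕ) (g : X → EuclideanSpace ℝ (Fin m)) (D : Set (EuclideanSpace ℝ (Fin m)))
      (xbar u : X), TwiceDifferentiableAt g xbar →
      (0 : EuclideanSpace ℝ (Fin m)) ∈ constraintMap g D xbar → ‖u‖ = 1 →
      IsLocallyPolyhedral D (g xbar) →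
      ∀ (v ys : EuclideanSpace ℝ (Fin m)) (xs : X),
        (xs ∈ gfrererPseudoCoderiv 2 (constraintMap g D) xbar 0 u v ys →
          dirNormalCone D (g xbar) (fderiv ℝ g xbar u - v) =
            limNormalCone (tangentCone D (g xbar)) (fderiv ℝ g xbar u - v) ∧
          ∃ zs ∈ tangentCone
              (limNormalCone (tangentCone D (g xbar)) (fderiv ℝ g xbar u - v)) ys,
            xs = scalarHess ys g xbar u + adjDeriv g xbar zs ∧
            ys ∈ dirNormalCone D (g xbar) (fderiv ℝ g xbar u - v) ∩ kerAdjDeriv g xbar) ∧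
        (xs ∈ pseudoCoderiv 2 (constraintMap g D) xbar 0 u v ys →
          ∃ s : X, ∃ zs ∈ tangentCone (limNormalCone (bigT g D xbar u) (wVec g xbar s u v)) ys,
            xs = scalarHess ys g xbar u + adjDeriv g xbar zs ∧
            ys ∈ limNormalCone (bigT g D xbar u) (wVec g xbar s u v) ∩ kerAdjDeriv g xbar)) := by
  refine ⟨fun Y _ _ _ g D xbar u hg h0 hu v ys xs h => ?_,
    fun m g D xbar u hg h0 hu hD v ys xs => ?_⟩
  · have hmem := mem_dirNormalCone_inter_kerAdjDeriv hg hu h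
    obtain ⟨z, hz, hxs⟩ := exists_inner_eq_zero_multiplier hg hu h
    refine ⟨⟨z, hz, hxs, hmem⟩, fun hreg => ?_⟩
    obtain ⟨z, hz, hxs⟩ := exists_graphicalDeriv_multiplier hg
      (by simpa using mem_constraintMap_iff.1 h0) hu h hreg
    exact ⟨z, hz, hxs, hmem⟩
  · have hx : g xbar ∈ D := by simpa using mem_constraintMap_iff.1 h0
    obtain ⟨𝓐, h𝓐⟩ := hD.exists_hasConicGerm
    refine ⟨fun h => ⟨?_, ?_⟩, fun h => ?_⟩
    · rw [h𝓐.dirNormalCone_eq isClosed_polyhedralCone,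
        h𝓐.tangentCone_eq isClosed_polyhedralCone hx]
    · obtain ⟨z, hz, hxs⟩ := exists_polyhedral_multiplier hg hx hu h𝓐 h
      exact ⟨z, hz, hxs, mem_dirNormalCone_inter_kerAdjDeriv hg hu h⟩
    · obtain ⟨s, z, hz, hxs, hker⟩ := exists_second_order_polyhedral_multiplier hg hx hu h𝓐 h
      rw [← secondDeriv_eq hg] at hz
      exact ⟨s, z, hz, hxs, hz.1, hker⟩

theorem theorem3p2 {X : Type*} [NormedAddCommGroup X] [InnerProductSpace ℝ X]
    [FiniteDimensional ℝ X] :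
    -- arbitrary Euclidean image space: parts (i) and (ii)
    (∀ (Y : Type*) [NormedAddCommGroup Y] [InnerProductSpace ℝ Y] [FiniteDimensional ℝ Y]
      (g : X → Y) (D : Set Y), ContDiff ℝ 2 g → IsClosed D →
      ∀ (xbar u : X), (0 : Y) ∈ constraintMap g D xbar → ‖u‖ = 1 →
      ∀ (v ys : Y) (xs : X),
        xs ∈ gfrererPseudoCoderiv 2 (constraintMap g D) xbar 0 u v ys →
        -- (i)
        (∃ zs : Y, inner ℝ ys zs = 0 ∧
          xs = scalarHess ys g xbar u + adjDeriv g xbar zs ∧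
          ys ∈ dirNormalCone D (g xbar) (fderiv ℝ g xbar u - v) ∩ kerAdjDeriv g xbar) ∧
        -- (ii)
        ((graphicalDeriv (limNormalCone D) (g xbar) ys 0 ∩ kerAdjDeriv g xbar = {0} ∨
          (fderiv ℝ g xbar u ≠ v ∧
            graphicalSubderiv (limNormalCone D) (g xbar) ys
              (‖fderiv ℝ g xbar u - v‖⁻¹ • (fderiv ℝ g xbar u - v)) ∩ kerAdjDeriv g xbar = ∅)) →
          ∃ zs ∈ graphicalDeriv (limNormalCone D) (g xbar) ys (fderiv ℝ g xbar u - v),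
            xs = scalarHess ys g xbar u + adjDeriv g xbar zs ∧
            ys ∈ dirNormalCone D (g xbar) (fderiv ℝ g xbar u - v) ∩ kerAdjDeriv g xbar)) ∧
    -- image space `ℝᵐ` and locally polyhedral `D`: parts (iii) and (iv)
    (∀ (m : ℕ) (g : X → EuclideanSpace ℝ (Fin m)) (D : Set (EuclideanSpace ℝ (Fin m))),
      ContDiff ℝ 2 g → IsClosed D →
      ∀ (xbar u : X), (0 : EuclideanSpace ℝ (Fin m)) ∈ constraintMap g D xbar → ‖u‖ = 1 →
      IsLocallyPolyhedral D (g xbar) →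
      ∀ (v ys : EuclideanSpace ℝ (Fin m)) (xs : X),
        -- (iii)
        (xs ∈ gfrererPseudoCoderiv 2 (constraintMap g D) xbar 0 u v ys →
          dirNormalCone D (g xbar) (fderiv ℝ g xbar u - v) =
            limNormalCone (tangentCone D (g xbar)) (fderiv ℝ g xbar u - v) ∧
          ∃ zs ∈ tangentCone
              (limNormalCone (tangentCone D (g xbar)) (fderiv ℝ g xbar u - v)) ys,
            xs = scalarHess ys g xbar u + adjDeriv g xbar zs ∧
            ys ∈ dirNormalCone D (g xbar) (fderiv ℝ g xbar u - v) ∩ kerAdjDeriv g xbar) ∧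
        -- (iv)
        (xs ∈ pseudoCoderiv 2 (constraintMap g D) xbar 0 u v ys →
          ∃ s : X, ∃ zs ∈ tangentCone (limNormalCone (bigT g D xbar u) (wVec g xbar s u v)) ys,
            xs = scalarHess ys g xbar u + adjDeriv g xbar zs ∧
            ys ∈ limNormalCone (bigT g D xbar u) (wVec g xbar s u v) ∩ kerAdjDeriv g xbar)) :=
  ⟨fun Y _ _ _ g D hg _ xbar u => theorem3p2_general.1 Y g D xbar u
      (twiceDifferentiableAt_of_contDiff hg xbar),
    fun m g D hg _ xbar u => theorem3p2_general.{_, 0}.2 m g D xbar u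
      (twiceDifferentiableAt_of_contDiff hg xbar)⟩
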